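/- Let $m\ge 0$ and let $V=(V_{ij})_{i,j=1}^2$ be a (not necessarily Hermitian) $2\times2$ matrix-valued potential on $\mathbb R$ with $V_{ij}\in L^1(\mathbb R)$ and \[ v:=\|V\|_1:=\int_{\mathbb R}\|V(x)\|\,dx<1, \] where $\|V(x)\|$ is the operator norm on $\mathbb C^2$ with the Euclidean norm (units $\hbar=c=1$). In $L^2(\mathbb R)\otimes\mathbb C^2$ let \[ H_0=-i\frac{d}{dx}\sigma_1+m\sigma_3,\qquad \operatorname{dom}H_0=H^1(\mathbb R)\otimes\mathbb C^2,\qquad \sigma_1=\begin{pmatrix}0&1\\1&0\end{pmatrix},\quad \sigma_3=\begin{pmatrix}1&0\\0&-1\end{pmatrix}, \] and $R_0(z)=(H_0-z)^{-1}$. Let $V=U|V|$ be the pointwise polar decomposition, $A=|V|^{1/2}$, $B=U|V|^{1/2}$ (maximal multiplication operators), and let $Q(z)$ be the bounded closure of $AR_0(z)B$. There is exactly one closed densely defined extension $H$ of $H_0+V$ with \[ (H-z)^{-1}=R_0(z)-\overline{R_0(z)B}\,(I+Q(z))^{-1}AR_0(z) \] for all $z\in\rho(H_0)$ for which $I+Q(z)$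 is boundedly invertible. Put \[ x_0=\sqrt{\frac{v^4-2v^2+2}{4(1-v^2)}+\frac12},\qquad r_0=\sqrt{\frac{v^4-2v^2+2}{4(1-v^2)}-\frac12}, \] and let $K_r(z_0)$ be the closed disk with centre $z_0$ and radius $r$ if $r>0$, and $K_0(z_0)=\emptyset$. Then the disks $K_{mr_0}(mx_0)$ and $K_{mr_0}(-mx_0)$ are disjoint, and the discrete spectrum $\sigma_{\rm d}(H)$, that is, the set of eigenvalues of $H$ of finite multiplicity that are isolated points of $\sigma(H)$, satisfies \[ \sigma_{\rm d}(H)\subset K_{mr_0}(mx_0)\cup K_{mr_0}(-mx_0). \] In particular, if $m=0$, then $H$ has no nonreal eigenvalues and $\sigma(H)=\mathbb R$. -/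

import Mathlib

open MeasureTheory

noncomputable section

namespace Dirac

/-! ### Unbounded operators on Hilbert spaces -/

section Operators

variable {E F : Type*} [NormedAddCommGroup E] [InnerProductSpace ℂ E]
  [NormedAddCommGroup F] [InnerProductSpace ℂ F]

/-- The bounded operator `R` is the resolvent `(T - z)⁻¹` of the operator `T`: it is a two-sided
inverse of `T - z : dom T → E`. -/
def IsResolvent (T : E →ₗ.[ℂ] E) (z : ℂ) (R : E →L[ℂ] E) : Prop :=
  (∀ g : E, ∃ h : R g ∈ T.domain, T ⟨R g, h⟩ - z • R g = g) ∧
    ∀ f : T.domain, R (T f - z • (f : E)) = f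

/-- The resolvent set `ρ(T)`. -/
def resolventSet (T : E →ₗ.[ℂ] E) : Set ℂ := {z | ∃ R : E →L[ℂ] E, IsResolvent T z R}

/-- The spectrum `σ(T) = ℂ \ ρ(T)`. -/
def spec (T : E →ₗ.[ℂ] E) : Set ℂ := (resolventSet T)ᶜ

/-- The eigenspace `ker (T - z)`, as a subspace of `dom T`. -/
def eigenspace (T : E →ₗ.[ℂ] E) (z : ℂ) : Submodule ℂ T.domain :=
  LinearMap.ker (T.toFun - z • T.domain.subtype)

/-- The set `σ_p(T)` of eigenvalues. -/
def pointSpec (T : E →ₗ.[ℂ] E) : Set ℂ := {z | eigenspace T z ≠ ⊥}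

/-- The discrete spectrum `σ_d(T)`: the eigenvalues of finite multiplicity, `dim ker (T - z) < ∞`,
that are isolated points of the spectrum. -/
def discreteSpec (T : E →ₗ.[ℂ] E) : Set ℂ :=
  {z | z ∈ pointSpec T ∧ FiniteDimensional ℂ (eigenspace T z) ∧
    ∃ ε > 0, ∀ w ∈ spec T, dist w z < ε → w = z}

/-- `T` is densely defined and its closure is the everywhere defined bounded operator `S`. -/
def HasBoundedClosure (T : E →ₗ.[ℂ] F) (S : E →L[ℂ] F) : Prop :=
  Dense (T.domain : Set E) ∧ ∀ f : T.domain, S f = T f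

/-- The bounded operators `R₀(z) = (H₀ - z)⁻¹`, `A R₀(z)`, the closure of `R₀(z) B` and the closure
`Q(z)` of `A R₀(z) B` that enter the Birman–Schwinger principle at a point `z` of `ρ(H₀)`. -/
structure BSData (H₀ : E →ₗ.[ℂ] E) (A : E →ₗ.[ℂ] F) (B : F →ₗ.[ℂ] E) (z : ℂ) where
  /-- the resolvent `R₀(z)` -/
  R₀ : E →L[ℂ] E
  isResolvent : IsResolvent H₀ z R₀
  /-- the operator `A R₀(z)`, everywhere defined and bounded -/
  AR₀ : E →L[ℂ] F
  AR₀_eq : ∀ g : E, ∃ h : R₀ g ∈ A.domain, AR₀ g = A ⟨R₀ g, h⟩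
  /-- the bounded closure of `R₀(z) B` -/
  R₀B : F →L[ℂ] E
  R₀B_closure : HasBoundedClosure ((R₀ : E →ₗ[ℂ] E).compPMap B) R₀B
  /-- the bounded closure of `A R₀(z) B` -/
  Q : F →L[ℂ] F
  Q_closure : HasBoundedClosure ((AR₀ : E →ₗ[ℂ] F).compPMap B) Q

end Operators

/-! ### The Hilbert space, the free operator, and multiplication operators -/

/-- The space `ℂ²` with the Euclidean norm. -/
abbrev C2 : Type := EuclideanSpace ℂ (Fin 2)

/-- The Hilbert space `L²(ℝ) ⊗ ℂ² = L²(ℝ, ℂ²)`. -/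
abbrev L2 : Type := Lp C2 2 (volume : Measure ℝ)

/-- `g ∈ L²` is the derivative of `f ∈ L²`: almost everywhere `f` agrees with the locally
absolutely continuous function `x ↦ c + ∫₀ˣ g`. The `f` that admit such a `g` form the Sobolev
space `H¹(ℝ, ℂ²)`. -/
def HasL2Deriv (f g : L2) : Prop :=
  ∃ c : C2, ∀ᵐ x : ℝ, f x = c + ∫ t in (0 : ℝ)..x, g t

lemma intervalIntegrable_L2 (g : L2) (a b : ℝ) : IntervalIntegrable (fun t => g t) volume a b := by
  have h : LocallyIntegrable (fun t => g t) (volume : Measure ℝ) :=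
    (Lp.memLp g).locallyIntegrable (by norm_num)
  exact (h.integrableOn_isCompact isCompact_uIcc).intervalIntegrable

/-- The graph of differentiation on `H¹(ℝ, ℂ²)`. -/
def derivGraph : Submodule ℂ (L2 × L2) where
  carrier := {p | HasL2Deriv p.1 p.2}
  zero_mem' := by
    refine ⟨0, ?_⟩
    have h : (fun t => (0 : L2) t) =ᵐ[volume] fun _ => (0 : C2) := Lp.coeFn_zero _ _ _
    filter_upwards [h] with x hx
    rw [Prod.fst_zero, hx, Prod.snd_zero,
      intervalIntegral.integral_congr_ae (g := fun _ => (0 : C2)) (h.mono fun t ht _ => ht)]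
    simp
  add_mem' := by
    rintro ⟨f₁, g₁⟩ ⟨f₂, g₂⟩ ⟨c₁, h₁⟩ ⟨c₂, h₂⟩
    refine ⟨c₁ + c₂, ?_⟩
    filter_upwards [h₁, h₂, Lp.coeFn_add f₁ f₂] with x hx₁ hx₂ hx
    simp only [Prod.mk_add_mk] at *
    rw [hx, Pi.add_apply, hx₁, hx₂,
      intervalIntegral.integral_congr_ae (g := fun t => g₁ t + g₂ t)
        ((Lp.coeFn_add g₁ g₂).mono fun t ht _ => ht),
      intervalIntegral.integral_add (intervalIntegrable_L2 _ _ _) (intervalIntegrable_L2 _ _ _)]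
    abel
  smul_mem' := by
    rintro a ⟨f, g⟩ ⟨c, h⟩
    refine ⟨a • c, ?_⟩
    filter_upwards [h, Lp.coeFn_smul a f] with x hx₁ hx
    simp only [Prod.smul_mk] at *
    rw [hx, Pi.smul_apply, hx₁,
      intervalIntegral.integral_congr_ae (g := fun t => a • g t)
        ((Lp.coeFn_smul a g).mono fun t ht _ => ht),
      intervalIntegral.integral_smul, smul_add]

/-- The derivative in `L²` is unique, so that `derivGraph` is the graph of an operator. -/
lemma derivGraph_functional (p : L2 × L2) (hp : p ∈ derivGraph) (h0 : p.1 = 0) : p.2 = 0 := by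
  obtain ⟨f, g⟩ := p
  obtain ⟨c, hc⟩ := hp
  simp only at h0 hc ⊢
  subst h0
  have hli : LocallyIntegrable (fun t => g t) (volume : Measure ℝ) :=
    (Lp.memLp g).locallyIntegrable (by norm_num)
  have hcont : Continuous fun x : ℝ => c + ∫ t in (0 : ℝ)..x, g t :=
    continuous_const.add
      (intervalIntegral.continuous_primitive (fun a b => intervalIntegrable_L2 g a b) 0)
  have hz : (fun x : ℝ => c + ∫ t in (0 : ℝ)..x, g t) = fun _ => 0 := by
    refine (Continuous.ae_eq_iff_eq volume hcont continuous_const).1 ?_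
    filter_upwards [hc, Lp.coeFn_zero C2 2 (volume : Measure ℝ)] with x h1 h2
    rw [← h1, h2, Pi.zero_apply]
  apply Lp.ext
  filter_upwards [LocallyIntegrable.ae_hasDerivAt_integral hli, Lp.coeFn_zero C2 2 (volume : Measure ℝ)] with x hx h2
  have h3 := (hx 0).const_add c
  rw [hz] at h3
  rw [h2, Pi.zero_apply]
  exact h3.unique (hasDerivAt_const x 0)

/-- The operator `d/dx` in `L²(ℝ, ℂ²)` with domain `H¹(ℝ, ℂ²)`. -/
def derivOp : L2 →ₗ.[ℂ] L2 := derivGraph.toLinearPMap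

/-- The Pauli matrix `σ₁`, acting on `ℂ²`. -/
def sigma1 : C2 →L[ℂ] C2 := Matrix.toEuclideanCLM (n := Fin 2) (𝕜 := ℂ) !![0, 1; 1, 0]

/-- The Pauli matrix `σ₃`, acting on `ℂ²`. -/
def sigma3 : C2 →L[ℂ] C2 := Matrix.toEuclideanCLM (n := Fin 2) (𝕜 := ℂ) !![1, 0; 0, -1]

/-- The free Dirac operator `H₀ = -i (d/dx) σ₁ + m σ₃` with domain `H¹(ℝ, ℂ²)`. -/
def freeDirac (m : ℝ) : L2 →ₗ.[ℂ] L2 where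
  domain := derivOp.domain
  toFun := (-Complex.I) • ((sigma1.compLpL 2 volume : L2 →L[ℂ] L2) : L2 →ₗ[ℂ] L2) ∘ₗ derivOp.toFun
    + (m : ℂ) • ((sigma3.compLpL 2 volume : L2 →L[ℂ] L2) : L2 →ₗ[ℂ] L2) ∘ₗ derivOp.domain.subtype

/-- The set of all `f ∈ L²` with `M f ∈ L²`, the domain of multiplication by the function `M` with
values in the linear operators on `ℂ²`. -/
def mulDomain (M : ℝ → C2 →L[ℂ] C2) : Submodule ℂ L2 where
  carrier := {f | MemLp (fun x => M x (f x)) 2 (volume : Measure ℝ)}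
  zero_mem' := by
    refine (memLp_congr_ae ?_).2 (MemLp.zero (ε := C2))
    filter_upwards [Lp.coeFn_zero C2 2 (volume : Measure ℝ)] with x hx
    rw [hx, Pi.zero_apply, map_zero]
  add_mem' := by
    intro f g hf hg
    refine (memLp_congr_ae ?_).2 (hf.add hg)
    filter_upwards [Lp.coeFn_add f g] with x hx
    rw [hx, Pi.add_apply, map_add, Pi.add_apply]
  smul_mem' := by
    intro a f hf
    refine (memLp_congr_ae ?_).2 (hf.const_smul a)
    filter_upwards [Lp.coeFn_smul a f] with x hx
    rw [hx, Pi.smul_apply, map_smul, Pi.smul_apply]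

lemma toLp_mul_add (M : ℝ → C2 →L[ℂ] C2) (f g h : L2) (hf : MemLp (fun x => M x (f x)) 2 volume)
    (hg : MemLp (fun x => M x (g x)) 2 volume) (hh : MemLp (fun x => M x (h x)) 2 volume)
    (e : h = f + g) : hh.toLp _ = hf.toLp _ + hg.toLp _ := by
  subst e
  rw [← MemLp.toLp_add]
  refine MemLp.toLp_congr _ _ ?_
  filter_upwards [Lp.coeFn_add f g] with x hx
  rw [hx, Pi.add_apply, map_add, Pi.add_apply]

lemma toLp_mul_smul (M : ℝ → C2 →L[ℂ] C2) (a : ℂ) (f h : L2)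
    (hf : MemLp (fun x => M x (f x)) 2 volume) (hh : MemLp (fun x => M x (h x)) 2 volume)
    (e : h = a • f) : hh.toLp _ = a • hf.toLp _ := by
  subst e
  rw [← MemLp.toLp_const_smul]
  refine MemLp.toLp_congr _ _ ?_
  filter_upwards [Lp.coeFn_smul a f] with x hx
  rw [hx, Pi.smul_apply, map_smul, Pi.smul_apply]

/-- The maximal operator of multiplication by the function `M` in `L²(ℝ, ℂ²)`. -/
def mulOp (M : ℝ → C2 →L[ℂ] C2) : L2 →ₗ.[ℂ] L2 where
  domain := mulDomain M
  toFun :=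
    { toFun := fun f => MemLp.toLp (fun x => M x ((f : L2) x)) f.2
      map_add' := fun f g => toLp_mul_add M f g _ f.2 g.2 (f + g).2 rfl
      map_smul' := fun a f => toLp_mul_smul M a f _ f.2 (a • f).2 rfl }

/-! ### The potential and the perturbed operator -/

/-- The value `V(x)` of the potential as a linear operator on the Euclidean space `ℂ²`. -/
def potOp (V : ℝ → Matrix (Fin 2) (Fin 2) ℂ) (x : ℝ) : C2 →L[ℂ] C2 :=
  Matrix.toEuclideanCLM (n := Fin 2) (𝕜 := ℂ) (V x)

/-- The norm `‖V‖₁ = ∫ ‖V(x)‖ dx`, with the operator norm of `V(x)`. -/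
def potNorm (V : ℝ → Matrix (Fin 2) (Fin 2) ℂ) : ℝ := ∫ x, ‖potOp V x‖

/-- The partial isometry `U = T |T|⁺` in the polar decomposition `T = U |T|`, where
`|T| = (T* T)^{1/2}`, and `|T|⁺` is the inverse of `|T|` on `(ker T)^⊥` and zero on `ker T`. -/
def polarU (T : C2 →L[ℂ] C2) : C2 →L[ℂ] C2 := T * cfc (fun t : ℝ => t⁻¹) (CFC.abs T)

/-- The factor `A = |V|^{1/2}` of the potential. -/
def factorA (V : ℝ → Matrix (Fin 2) (Fin 2) ℂ) (x : ℝ) : C2 →L[ℂ] C2 :=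
  CFC.sqrt (CFC.abs (potOp V x))

/-- The factor `B = U |V|^{1/2}` of the potential, so that `V = B A`. -/
def factorB (V : ℝ → Matrix (Fin 2) (Fin 2) ℂ) (x : ℝ) : C2 →L[ℂ] C2 :=
  polarU (potOp V x) * CFC.sqrt (CFC.abs (potOp V x))

/-- `H` is the Dirac operator with mass `m` and potential `V`: the closed densely defined extension
of `H₀ + V` with resolvent
`(H - z)⁻¹ = R₀(z) - R₀(z) B (1 + Q(z))⁻¹ A R₀(z)`
(with `R₀(z) B` and `Q(z) = A R₀(z) B` replaced by their bounded closures)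
at every `z` of `ρ(H₀)` for which `1 + Q(z)` is boundedly invertible. -/
structure IsDirac (m : ℝ) (V : ℝ → Matrix (Fin 2) (Fin 2) ℂ) (H : L2 →ₗ.[ℂ] L2) : Prop where
  isClosed : H.IsClosed
  dense_domain : Dense (H.domain : Set L2)
  extends_sum : freeDirac m + mulOp (potOp V) ≤ H
  resolvent_formula : ∀ (z : ℂ)
    (D : BSData (freeDirac m) (mulOp (factorA V)) (mulOp (factorB V)) z), IsUnit (1 + D.Q) →
      IsResolvent H z (D.R₀ - D.R₀B ∘L Ring.inverse (1 + D.Q) ∘L D.AR₀)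

/-! ### The two disks -/

/-- The number `x₀`, as a function of `v = ‖V‖₁`. -/
def x₀ (v : ℝ) : ℝ := √((v ^ 4 - 2 * v ^ 2 + 2) / (4 * (1 - v ^ 2)) + 1 / 2)

/-- The number `r₀`, as a function of `v = ‖V‖₁`. -/
def r₀ (v : ℝ) : ℝ := √((v ^ 4 - 2 * v ^ 2 + 2) / (4 * (1 - v ^ 2)) - 1 / 2)

/-- The closed disk `K_r(z₀)` for `r > 0`; by convention it is empty for `r = 0`. -/
def disk (r : ℝ) (z₀ : ℂ) : Set ℂ := {z | 0 < r ∧ dist z z₀ ≤ r}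

end Dirac

end

/-!
Write `k² = z² - m²` with `Im k > 0`, which is possible exactly for `z` off the set
`{λ ∈ ℝ : |λ| ≥ m}`. The equation `(H₀ - z) f = g` is the first order system
`f' = N f + i σ₁ g` with `N² = (ik)²`, so the resolvent of `H₀` at `z` is the integral operator with
kernel `e^{ik|x-y|} M±`, where `±` is the sign of `x - y` and `M±` is a constant matrix
(`isResolvent_freeResolvent`). The matrix `M±` has rank one, and its norm is
`c = (|z + m| + |z - m|) / (2 |k|)` (`norm_kernelCoeff_le`, `kernelBound`). Hence the kernel is
bounded by `c` uniformly in `x` and `y`. Multiplication by `A` and by `B` maps `L^∞` to `L²` and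
`L²` to `L¹`, each with norm at most `‖V‖₁^{1/2}`, so that `‖Q(z)‖ ≤ c ‖V‖₁` (`exists_BSData`).
Since `x₀² - r₀² = 1`, the points `z` outside of the two disks are exactly those with
`c ‖V‖₁ < 1` (`kernelBound_mul_lt_one`), and there `1 + Q(z)` is invertible.

The operator `H` is constructed from the resolvent formula at the single point `z = i`, which is
never in the disks. The right-hand side of the formula is injective because `A` is closed
(`formula_injective`), and it has dense range by the dual argument for the adjoints
(`dense_range_formula`), so it is `(H - i)⁻¹` for a closed densely defined operator `H`. The
right-hand sides at different points satisfy the first resolvent identity (`formula_sub`), so the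
formula holds for this `H` at every admissible point; uniqueness is clear, since a single resolvent
determines the operator. Therefore `σ(H)` is contained in the union of the disks and of
`{λ ∈ ℝ : |λ| ≥ m}` (`spec_subset`).

Conversely, every real `λ` with `|λ| ≥ m` belongs to `σ(H)`: a plane wave for the energy `λ`, cut
off at the scale `1/ε`, is an approximate eigenfunction of `H₀`, and `A` is small on it relative to
its norm, because `A` is square integrable and the wave is spread out
(`exists_approximate_eigenfunction`); the resolvent formula turns such functions into approximate
eigenfunctions of `H` (`BSData.mem_spec_of_approximate`). So no point of this set is isolated in
`σ(H)` (`not_isolated_of_real`), and the discrete spectrum lies in the disks. For `m = 0` the disks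
are empty by convention and `σ(H) = ℝ`.
-/

open MeasureTheory

noncomputable section

namespace Dirac

/-! ### Resolvents of unbounded operators -/

section Resolvents

variable {E F : Type*} [NormedAddCommGroup E] [InnerProductSpace ℂ E]
  [NormedAddCommGroup F] [InnerProductSpace ℂ F]

lemma IsResolvent.mem_domain {T : E →ₗ.[ℂ] E} {z : ℂ} {R : E →L[ℂ] E} (h : IsResolvent T z R)
    (g : E) : R g ∈ T.domain := (h.1 g).1

lemma IsResolvent.apply_apply {T : E →ₗ.[ℂ] E} {z : ℂ} {R : E →L[ℂ] E} (h : IsResolvent T z R)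
    (g : E) (hg : R g ∈ T.domain) : T ⟨R g, hg⟩ = g + z • R g := by
  obtain ⟨_, h2⟩ := h.1 g
  exact sub_eq_iff_eq_add.1 h2

/-- The first resolvent identity. -/
lemma IsResolvent.apply_sub_apply {T : E →ₗ.[ℂ] E} {z w : ℂ} {R R' : E →L[ℂ] E}
    (h : IsResolvent T z R) (h' : IsResolvent T w R') (g : E) :
    R' g - R g = (w - z) • R' (R g) := by
  have h1 := h'.2 ⟨R g, h.mem_domain g⟩
  rw [h.apply_apply] at h1
  have h2 : g + z • R g - w • R g = g - (w - z) • R g := by module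
  simp only [h2, map_sub, map_smul] at h1
  rw [sub_eq_iff_eq_add] at h1 ⊢
  rw [h1]; abel

lemma IsResolvent.eq_iff {T : E →ₗ.[ℂ] E} {z : ℂ} {R : E →L[ℂ] E} (h : IsResolvent T z R)
    (f : T.domain) (g : E) : T f - z • (f : E) = g ↔ R g = f := by
  constructor
  · rintro rfl
    exact h.2 f
  · intro hg
    obtain ⟨h1, h2⟩ := h.1 g
    have : (⟨R g, h1⟩ : T.domain) = f := Subtype.ext hg
    rw [this, hg] at h2
    exact h2

lemma IsResolvent.mem_graph_iff {T : E →ₗ.[ℂ] E} {z : ℂ} {R : E →L[ℂ] E} (h : IsResolvent T z R)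
    (p : E × E) : p ∈ T.graph ↔ R (p.2 - z • p.1) = p.1 := by
  obtain ⟨f, g⟩ := p
  rw [LinearPMap.mem_graph_iff]
  constructor
  · rintro ⟨y, rfl, rfl⟩
    exact h.2 y
  · intro hf
    simp only at hf
    have hm : f ∈ T.domain := hf ▸ h.mem_domain _
    refine ⟨⟨f, hm⟩, rfl, ?_⟩
    have := (h.eq_iff ⟨f, hm⟩ (g - z • f)).2 hf
    simpa using this

/-- An operator is determined by its resolvent at a single point. -/
lemma IsResolvent.operator_unique {T T' : E →ₗ.[ℂ] E} {z : ℂ} {R : E →L[ℂ] E}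
    (h : IsResolvent T z R) (h' : IsResolvent T' z R) : T = T' := by
  refine LinearPMap.eq_of_eq_graph ?_
  ext p
  rw [h.mem_graph_iff, h'.mem_graph_iff]

lemma IsResolvent.isClosed {T : E →ₗ.[ℂ] E} {z : ℂ} {R : E →L[ℂ] E} (h : IsResolvent T z R) :
    T.IsClosed := by
  have : (T.graph : Set (E × E)) = {p | R (p.2 - z • p.1) = p.1} := by
    ext p
    exact h.mem_graph_iff p
  unfold LinearPMap.IsClosed
  rw [this]
  exact isClosed_eq (by fun_prop) (by fun_prop)

/-- The operator `z + R⁻¹`, with the range of the injective operator `R` as its domain. -/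
def ofResolvent (z : ℂ) (R : E →L[ℂ] E) (hR : Function.Injective R) : E →ₗ.[ℂ] E where
  domain := LinearMap.range (R : E →ₗ[ℂ] E)
  toFun := ((LinearEquiv.ofInjective (R : E →ₗ[ℂ] E) hR).symm : _ →ₗ[ℂ] E)
    + z • (LinearMap.range (R : E →ₗ[ℂ] E)).subtype

lemma isResolvent_ofResolvent (z : ℂ) (R : E →L[ℂ] E) (hR : Function.Injective R) :
    IsResolvent (ofResolvent z R hR) z R := by
  have key : ∀ (g : E) (h : R g ∈ (ofResolvent z R hR).domain),
      ofResolvent z R hR ⟨R g, h⟩ = g + z • R g := by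
    intro g h
    change (LinearEquiv.ofInjective (R : E →ₗ[ℂ] E) hR).symm ⟨R g, h⟩ + z • R g = g + z • R g
    rw [add_left_inj, LinearEquiv.symm_apply_eq]
    rfl
  constructor
  · intro g
    have h : R g ∈ (ofResolvent z R hR).domain := ⟨g, rfl⟩
    exact ⟨h, by rw [key g h, add_sub_cancel_right]⟩
  · rintro ⟨_, g, rfl⟩
    have h : R g ∈ (ofResolvent z R hR).domain := ⟨g, rfl⟩
    change R (ofResolvent z R hR ⟨R g, h⟩ - z • R g) = R g
    rw [key g h, add_sub_cancel_right]

/-- A bounded operator that satisfies both resolvent identities with a resolvent of `T` is a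
resolvent of `T`. -/
lemma IsResolvent.of_resolvent_identity {T : E →ₗ.[ℂ] E} {z w : ℂ} {R R' : E →L[ℂ] E}
    (h : IsResolvent T z R) (h1 : ∀ g, R' g - R g = (w - z) • R' (R g))
    (h2 : ∀ g, R' g - R g = (w - z) • R (R' g)) : IsResolvent T w R' := by
  have e : ∀ g, R (g + (w - z) • R' g) = R' g := by
    intro g
    rw [map_add, map_smul, ← h2]; abel
  constructor
  · intro g
    have hm : R' g ∈ T.domain := e g ▸ h.mem_domain _
    refine ⟨hm, ?_⟩
    have := (h.eq_iff ⟨R' g, hm⟩ _).2 (e g)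
    rw [sub_eq_iff_eq_add] at this ⊢
    rw [this]
    module
  · intro f
    have hf := h.2 f
    have h3 : T f - w • (f : E) = (T f - z • (f : E)) - (w - z) • (f : E) := by module
    have h4 := h1 (T f - z • (f : E))
    rw [hf] at h4
    rw [h3, map_sub, map_smul, ← h4]; abel

lemma pointSpec_subset_spec (T : E →ₗ.[ℂ] E) : pointSpec T ⊆ spec T := by
  rintro z hz ⟨R, hR⟩
  refine hz ((Submodule.eq_bot_iff _).2 fun f hf => ?_)
  have h1 : T f - z • (f : E) = 0 := hf
  have h2 := hR.2 f
  rw [h1, map_zero] at h2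
  exact Subtype.ext h2.symm

/-- A densely defined bounded operator has a bounded closure, with the same bound. -/
lemma exists_hasBoundedClosure [CompleteSpace F] (T : E →ₗ.[ℂ] F) (hT : Dense (T.domain : Set E))
    (C : ℝ) (hC : ∀ f : T.domain, ‖T f‖ ≤ C * ‖(f : E)‖) :
    ∃ S : E →L[ℂ] F, HasBoundedClosure T S ∧ ∀ f, ‖S f‖ ≤ C * ‖f‖ := by
  have hd : DenseRange T.domain.subtype := by
    simpa [DenseRange] using hT
  exact ⟨T.toFun.extendOfNorm T.domain.subtype,
    ⟨hT, fun f => LinearMap.extendOfNorm_eq hd ⟨C, hC⟩ f⟩,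
    fun f => LinearMap.norm_extendOfNorm_apply_le hd C hC f⟩

lemma ext_of_dense {T T' : E →L[ℂ] F} {s : Set E} (hs : Dense s) (h : ∀ f ∈ s, T f = T' f) :
    T = T' :=
  ContinuousLinearMap.ext fun f =>
    congrFun (T.continuous.ext_on hs T'.continuous h) f

end Resolvents

/-! ### The resolvent formula of the Birman–Schwinger principle -/

section BirmanSchwinger

variable {E F : Type*} [NormedAddCommGroup E] [InnerProductSpace ℂ E]
  [NormedAddCommGroup F] [InnerProductSpace ℂ F]
  {H₀ : E →ₗ.[ℂ] E} {A : E →ₗ.[ℂ] F} {B : F →ₗ.[ℂ] E} {z w : ℂ}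

namespace BSData

lemma dense_domain (D : BSData H₀ A B z) : Dense (B.domain : Set F) := D.R₀B_closure.1

lemma R₀B_apply (D : BSData H₀ A B z) (f : B.domain) : D.R₀B f = D.R₀ (B f) :=
  D.R₀B_closure.2 f

lemma Q_apply (D : BSData H₀ A B z) (f : B.domain) : D.Q f = D.AR₀ (B f) :=
  D.Q_closure.2 f

lemma apply_eq_AR₀ (D : BSData H₀ A B z) (g : E) (h : D.R₀ g ∈ A.domain) :
    A ⟨D.R₀ g, h⟩ = D.AR₀ g := by
  obtain ⟨_, h2⟩ := D.AR₀_eq g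
  exact h2.symm

lemma R₀_mem (D : BSData H₀ A B z) (g : E) : D.R₀ g ∈ A.domain := (D.AR₀_eq g).1

lemma AR₀_sub (D : BSData H₀ A B z) (D' : BSData H₀ A B w) (g : E) :
    D'.AR₀ g - D.AR₀ g = (w - z) • D'.AR₀ (D.R₀ g) := by
  have h := D.isResolvent.apply_sub_apply D'.isResolvent g
  rw [← D'.apply_eq_AR₀ g (D'.R₀_mem g), ← D.apply_eq_AR₀ g (D.R₀_mem g),
    ← D'.apply_eq_AR₀ (D.R₀ g) (D'.R₀_mem _), ← LinearPMap.map_sub, ← LinearPMap.map_smul]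
  congr 1
  exact Subtype.ext h

lemma R₀B_sub (D : BSData H₀ A B z) (D' : BSData H₀ A B w) (f : F) :
    D'.R₀B f - D.R₀B f = (w - z) • D'.R₀ (D.R₀B f) := by
  have : D'.R₀B - D.R₀B = (w - z) • (D'.R₀ ∘L D.R₀B) := by
    refine ext_of_dense D.dense_domain fun f hf => ?_
    have h1 := D.R₀B_apply ⟨f, hf⟩
    have h2 := D'.R₀B_apply ⟨f, hf⟩
    simp only at h1 h2
    simp [h1, h2, D.isResolvent.apply_sub_apply D'.isResolvent]
  exact DFunLike.congr_fun this f

lemma Q_sub (D : BSData H₀ A B z) (D' : BSData H₀ A B w) (f : F) :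
    D'.Q f - D.Q f = (w - z) • D'.AR₀ (D.R₀B f) := by
  have : D'.Q - D.Q = (w - z) • (D'.AR₀ ∘L D.R₀B) := by
    refine ext_of_dense D.dense_domain fun f hf => ?_
    have h1 := D.R₀B_apply ⟨f, hf⟩
    have h2 := D'.Q_apply ⟨f, hf⟩
    have h3 := D.Q_apply ⟨f, hf⟩
    simp only at h1 h2 h3
    simp [h1, h2, h3, D.AR₀_sub D']
  exact DFunLike.congr_fun this f

/-- The right-hand side `R₀(z) - R₀(z) B (1 + Q(z))⁻¹ A R₀(z)` of the resolvent formula. -/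
def formula (D : BSData H₀ A B z) : E →L[ℂ] E :=
  D.R₀ - D.R₀B ∘L Ring.inverse (1 + D.Q) ∘L D.AR₀

lemma formula_apply (D : BSData H₀ A B z) (g : E) :
    D.formula g = D.R₀ g - D.R₀B (Ring.inverse (1 + D.Q) (D.AR₀ g)) := rfl

lemma inverse_apply (D : BSData H₀ A B z) (hD : IsUnit (1 + D.Q)) (f : F) :
    Ring.inverse (1 + D.Q) f + Ring.inverse (1 + D.Q) (D.Q f) = f := by
  have h := DFunLike.congr_fun (Ring.inverse_mul_cancel _ hD) f
  simpa using h

lemma apply_inverse (D : BSData H₀ A B z) (hD : IsUnit (1 + D.Q)) (f : F) :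
    Ring.inverse (1 + D.Q) f + D.Q (Ring.inverse (1 + D.Q) f) = f := by
  have h := DFunLike.congr_fun (Ring.mul_inverse_cancel _ hD) f
  simpa using h

/-- The right-hand sides of the resolvent formula satisfy the first resolvent identity. -/
lemma formula_sub (D : BSData H₀ A B z) (D' : BSData H₀ A B w) (hD : IsUnit (1 + D.Q))
    (hD' : IsUnit (1 + D'.Q)) (g : E) :
    D'.formula g - D.formula g = (w - z) • D'.formula (D.formula g) := by
  simp only [formula_apply, map_sub, smul_sub]
  set φ : F := Ring.inverse (1 + D.Q) (D.AR₀ g) with hφ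
  rw [← D.isResolvent.apply_sub_apply D'.isResolvent, ← D.R₀B_sub D']
  have e1 : (w - z) • D'.R₀B (Ring.inverse (1 + D'.Q) (D'.AR₀ (D.R₀ g)))
      = D'.R₀B (Ring.inverse (1 + D'.Q) (D'.AR₀ g))
        - D'.R₀B (Ring.inverse (1 + D'.Q) (D.AR₀ g)) := by
    rw [← map_smul, ← map_smul, ← D.AR₀_sub D', map_sub, map_sub]
  have e2 : (w - z) • D'.R₀B (Ring.inverse (1 + D'.Q) (D'.AR₀ (D.R₀B φ)))
      = D'.R₀B φ - D'.R₀B (Ring.inverse (1 + D'.Q) (D.AR₀ g)) := by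
    rw [← map_smul, ← map_smul, ← D.Q_sub D', ← map_sub]
    congr 1
    have h1 := D'.inverse_apply hD' φ
    have h2 := congrArg (Ring.inverse (1 + D'.Q) : F →L[ℂ] F) (D.apply_inverse hD (D.AR₀ g))
    rw [← hφ, map_add] at h2
    rw [← h2, map_sub]
    nth_rewrite 3 [← h1]
    abel
  rw [e1, e2]
  abel

/-- If `A` is closed, then it maps the range of the closure of `R₀(z) B` by `Q(z)`. -/
lemma R₀B_mem_domain (D : BSData H₀ A B z) (hA : A.IsClosed) (f : F) :
    ∃ h : D.R₀B f ∈ A.domain, A ⟨D.R₀B f, h⟩ = D.Q f := by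
  have hg : (D.R₀B f, D.Q f) ∈ A.graph := by
    have hc : IsClosed {f : F | (D.R₀B f, D.Q f) ∈ (A.graph : Set (E × F))} :=
      IsClosed.preimage (f := fun f : F => (D.R₀B f, D.Q f)) (by fun_prop) hA
    refine D.dense_domain.induction (P := fun f => (D.R₀B f, D.Q f) ∈ (A.graph : Set (E × F)))
      (fun f hf => ?_) hc f
    rw [SetLike.mem_coe, D.R₀B_apply ⟨f, hf⟩, D.Q_apply ⟨f, hf⟩,
      ← D.apply_eq_AR₀ _ (D.R₀_mem _)]
    exact A.mem_graph ⟨_, _⟩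
  obtain ⟨y, hy1, hy2⟩ := A.mem_graph_iff.1 hg
  simp only at hy1 hy2
  refine ⟨hy1 ▸ y.2, ?_⟩
  rw [← hy2]
  congr 1
  exact Subtype.ext hy1.symm

lemma R₀_injective (D : BSData H₀ A B z) {g : E} (hg : D.R₀ g = 0) : g = 0 := by
  have h := D.isResolvent.apply_apply g (D.isResolvent.mem_domain g)
  have h0 : (⟨D.R₀ g, D.isResolvent.mem_domain g⟩ : H₀.domain) = 0 := Subtype.ext hg
  rw [h0, LinearPMap.map_zero, hg, smul_zero, add_zero] at h
  exact h.symm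

/-- If the right-hand side of the resolvent formula vanishes on `g`, then `φ = (1 + Q)⁻¹ A R₀ g`
satisfies `R₀ g = R₀B φ`; applying the closed operator `A` gives `(1 + Q) φ = Q φ`. -/
lemma formula_injective (D : BSData H₀ A B z) (hA : A.IsClosed) (hD : IsUnit (1 + D.Q)) :
    Function.Injective D.formula := by
  rw [injective_iff_map_eq_zero]
  intro g hg
  rw [formula_apply, sub_eq_zero] at hg
  set φ : F := Ring.inverse (1 + D.Q) (D.AR₀ g) with hφ
  obtain ⟨h1, h2⟩ := D.R₀B_mem_domain hA φ
  have h3 : D.AR₀ g = D.Q φ := by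
    rw [← D.apply_eq_AR₀ g (D.R₀_mem g), ← h2]
    congr 1
    exact Subtype.ext hg
  have h4 := D.apply_inverse hD (D.AR₀ g)
  rw [← hφ, h3, add_eq_right] at h4
  rw [h4, map_zero] at hg
  exact D.R₀_injective hg

/-- A vector orthogonal to the range is in the kernel of the adjoint, which has the same structure as
the right-hand side of the resolvent formula. -/
lemma dense_range_formula [CompleteSpace E] [CompleteSpace F] (D : BSData H₀ A B z)
    (hH₀ : Dense (H₀.domain : Set E)) (hD : IsUnit (1 + D.Q)) :
    Dense (LinearMap.range (D.formula : E →ₗ[ℂ] E) : Set E) := by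
  rw [Submodule.dense_iff_topologicalClosure_eq_top, Submodule.topologicalClosure_eq_top_iff,
    Submodule.eq_bot_iff]
  intro f hf
  have hf' : ∀ g, inner ℂ (D.formula g) f = 0 := fun g =>
    (Submodule.mem_orthogonal _ f).1 hf _ ⟨g, rfl⟩
  -- `ψ` plays the role of `(1 + Q*)⁻¹ (R₀ B)* f`, and `R₀* f = (A R₀)* ψ`.
  set ψ := ContinuousLinearMap.adjoint (Ring.inverse (1 + D.Q))
    (ContinuousLinearMap.adjoint D.R₀B f) with hψ
  have h1 : ∀ g, inner ℂ (D.R₀ g) f = inner ℂ (D.AR₀ g) ψ := by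
    intro g
    have := hf' g
    rw [formula_apply, inner_sub_left, sub_eq_zero] at this
    rw [this, hψ, ContinuousLinearMap.adjoint_inner_right, ContinuousLinearMap.adjoint_inner_right]
  have h2 : ∀ φ : F, inner ℂ (D.R₀B φ) f = inner ℂ (D.Q φ) ψ := by
    intro φ
    have hc : IsClosed {φ : F | inner ℂ (D.R₀B φ) f = inner ℂ (D.Q φ) ψ} :=
      isClosed_eq (by fun_prop) (by fun_prop)
    refine D.dense_domain.induction (P := fun φ => inner ℂ (D.R₀B φ) f = inner ℂ (D.Q φ) ψ)
      (fun φ hφ => ?_) hc φ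
    rw [D.R₀B_apply ⟨φ, hφ⟩, D.Q_apply ⟨φ, hφ⟩, h1]
  have h3 : ∀ φ : F, inner ℂ (Ring.inverse (1 + D.Q) φ) ψ = 0 := by
    intro φ
    have h4 := h2 (Ring.inverse (1 + D.Q) φ)
    have h5 : inner ℂ (D.R₀B (Ring.inverse (1 + D.Q) φ)) f = inner ℂ φ ψ := by
      rw [hψ, ContinuousLinearMap.adjoint_inner_right, ContinuousLinearMap.adjoint_inner_right]
    rw [h5] at h4
    have h6 := congrArg (fun y => inner ℂ y ψ) (D.apply_inverse hD φ)
    simp only [inner_add_left] at h6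
    rw [← h4, add_eq_right] at h6
    exact h6
  have h4 : ψ = 0 := by
    refine ext_inner_left ℂ fun φ => ?_
    rw [← D.inverse_apply hD φ, ← map_add, h3, inner_zero_right]
  simp only [h4, inner_zero_right] at h1
  refine hH₀.eq_zero_of_inner_right (𝕜 := ℂ) fun v hv => ?_
  have := h1 (H₀ ⟨v, hv⟩ - z • v)
  rwa [D.isResolvent.2 ⟨v, hv⟩] at this

/-- On the domain of `H₀ + B A` the right-hand side of the resolvent formula inverts
`H₀ + B A - z`. -/
lemma formula_apply_sum (D : BSData H₀ A B z) (hD : IsUnit (1 + D.Q)) (f : E)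
    (h₀ : f ∈ H₀.domain) (hA : f ∈ A.domain) (hB : A ⟨f, hA⟩ ∈ B.domain) :
    D.formula (H₀ ⟨f, h₀⟩ + B ⟨A ⟨f, hA⟩, hB⟩ - z • f) = f := by
  have h1 : D.R₀ (H₀ ⟨f, h₀⟩ - z • f) = f := D.isResolvent.2 ⟨f, h₀⟩
  have h2 : D.AR₀ (H₀ ⟨f, h₀⟩ - z • f) = A ⟨f, hA⟩ := by
    rw [← D.apply_eq_AR₀ _ (D.R₀_mem _)]
    congr 1
    exact Subtype.ext h1
  have h3 := D.R₀B_apply ⟨_, hB⟩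
  have h4 := D.Q_apply ⟨_, hB⟩
  have h5 : H₀ ⟨f, h₀⟩ + B ⟨A ⟨f, hA⟩, hB⟩ - z • f
      = (H₀ ⟨f, h₀⟩ - z • f) + B ⟨A ⟨f, hA⟩, hB⟩ := by abel
  rw [h5, formula_apply, map_add, map_add, h1, h2, ← h3, ← h4, map_add,
    D.inverse_apply hD]
  abel

/-- If the resolvent formula holds at one point, then it holds at all admissible points. -/
lemma isResolvent_formula (D : BSData H₀ A B z) (D' : BSData H₀ A B w) (hD : IsUnit (1 + D.Q))
    (hD' : IsUnit (1 + D'.Q)) {H : E →ₗ.[ℂ] E} (hH : IsResolvent H z D.formula) :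
    IsResolvent H w D'.formula := by
  refine hH.of_resolvent_identity (fun g => D.formula_sub D' hD hD' g) fun g => ?_
  have := D'.formula_sub D hD' hD g
  rw [← neg_sub, this, ← neg_smul, neg_sub]

end BSData

end BirmanSchwinger

/-! ### The polar decomposition of an operator on `ℂ²` -/

section Polar

lemma continuous_sqrt_abs : Continuous fun T : C2 →L[ℂ] C2 => CFC.sqrt (CFC.abs T) := by
  simp only [CFC.sqrt_eq_cfc]
  exact Continuous.cfc_nnreal_of_mem_nhdsSet (s := Set.univ) NNReal.sqrt Filter.univ_mem
    CFC.continuous_abs (fun T => CFC.abs_nonneg T) (by fun_prop)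

lemma norm_apply_eq_norm_abs_apply (T : C2 →L[ℂ] C2) (v : C2) : ‖T v‖ = ‖CFC.abs T v‖ := by
  have h : star (CFC.abs T) * CFC.abs T = star T * T := by
    rw [(CFC.abs_nonneg T).isSelfAdjoint.star_eq, CFC.abs_mul_abs]
  have h' := congrArg (fun S : C2 →L[ℂ] C2 => inner ℂ (S v) v) h
  simp only [ContinuousLinearMap.star_eq_adjoint, mul_apply_eq_comp,
    ContinuousLinearMap.adjoint_inner_left, inner_self_eq_norm_sq_to_K] at h'
  have h'' : ‖CFC.abs T v‖ ^ 2 = ‖T v‖ ^ 2 := by exact_mod_cast h'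
  exact ((sq_eq_sq₀ (norm_nonneg _) (norm_nonneg _)).1 h'').symm

lemma norm_mul_eq_norm_abs_mul (T S : C2 →L[ℂ] C2) : ‖T * S‖ = ‖CFC.abs T * S‖ := by
  refine le_antisymm (ContinuousLinearMap.opNorm_le_bound _ (norm_nonneg _) fun v => ?_)
    (ContinuousLinearMap.opNorm_le_bound _ (norm_nonneg _) fun v => ?_)
  · have := (CFC.abs T * S).le_opNorm v
    simpa [norm_apply_eq_norm_abs_apply T] using this
  · have := (T * S).le_opNorm v
    simpa [norm_apply_eq_norm_abs_apply T] using this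

/-- The spectrum is finite, so that every real function may be inserted into the functional
calculus. -/
lemma finite_spectrum (T : C2 →L[ℂ] C2) : (spectrum ℝ T).Finite := by
  obtain ⟨M, rfl⟩ := (Matrix.toEuclideanCLM (n := Fin 2) (𝕜 := ℂ)).surjective T
  rw [← spectrum.preimage_algebraMap ℂ]
  refine Set.Finite.preimage (FaithfulSMul.algebraMap_injective ℝ ℂ).injOn ?_
  have := AlgEquiv.spectrum_eq (R := ℂ) (Matrix.toEuclideanCLM (n := Fin 2) (𝕜 := ℂ)) M
  exact (congrArg Set.Finite this).mpr M.finite_spectrum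

lemma continuousOn_spectrum (f : ℝ → ℝ) (T : C2 →L[ℂ] C2) : ContinuousOn f (spectrum ℝ T) :=
  (finite_spectrum T).continuousOn f

lemma isSelfAdjoint_abs (T : C2 →L[ℂ] C2) : IsSelfAdjoint (CFC.abs T) :=
  (CFC.abs_nonneg T).isSelfAdjoint

lemma sqrt_abs_eq_cfc (T : C2 →L[ℂ] C2) : CFC.sqrt (CFC.abs T) = cfc Real.sqrt (CFC.abs T) := by
  rw [CFC.sqrt_eq_real_sqrt _ (CFC.abs_nonneg T),
    cfcₙ_eq_cfc (Real.continuous_sqrt.continuousOn) Real.sqrt_zero]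

lemma cfc_mul_cfc_abs (f g : ℝ → ℝ) (T : C2 →L[ℂ] C2) :
    cfc f (CFC.abs T) * cfc g (CFC.abs T) = cfc (fun t => f t * g t) (CFC.abs T) :=
  (cfc_mul f g _ (continuousOn_spectrum _ _) (continuousOn_spectrum _ _)).symm

lemma abs_mul_cfc_abs (g : ℝ → ℝ) (T : C2 →L[ℂ] C2) :
    CFC.abs T * cfc g (CFC.abs T) = cfc (fun t => t * g t) (CFC.abs T) := by
  rw [← cfc_mul_cfc_abs (fun t => t), cfc_id' ℝ (CFC.abs T) (isSelfAdjoint_abs T)]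

lemma cfc_mul_abs (g : ℝ → ℝ) (T : C2 →L[ℂ] C2) :
    cfc g (CFC.abs T) * CFC.abs T = cfc (fun t => g t * t) (CFC.abs T) := by
  rw [← cfc_mul_cfc_abs, cfc_id' ℝ (CFC.abs T) (isSelfAdjoint_abs T)]

/-- The polar decomposition. Here `T (1 - |T|⁻¹ |T|) = 0`, although `|T|⁻¹ |T|` is only the projection
onto the orthogonal complement of the kernel, because `|T|` annihilates `1 - |T|⁻¹ |T|`. -/
lemma polarU_mul_abs (T : C2 →L[ℂ] C2) : polarU T * CFC.abs T = T := by
  have h : T * (1 - cfc (fun t : ℝ => t⁻¹) (CFC.abs T) * CFC.abs T) = 0 := by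
    rw [← norm_eq_zero, norm_mul_eq_norm_abs_mul, norm_eq_zero, mul_sub, mul_one, ← mul_assoc,
      abs_mul_cfc_abs, cfc_mul_abs, sub_eq_zero]
    simp only [mul_inv_mul_cancel]
    exact (cfc_id' ℝ (CFC.abs T) (isSelfAdjoint_abs T)).symm
  rw [mul_sub, mul_one, sub_eq_zero] at h
  rw [polarU, mul_assoc, ← h]

lemma polarU_mul_sqrt (T : C2 →L[ℂ] C2) :
    polarU T * CFC.sqrt (CFC.abs T) = T * cfc (fun t : ℝ => t⁻¹ * √t) (CFC.abs T) := by
  rw [polarU, sqrt_abs_eq_cfc, mul_assoc, cfc_mul_cfc_abs]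

lemma norm_sqrt_abs_sq (T : C2 →L[ℂ] C2) : ‖CFC.sqrt (CFC.abs T)‖ ^ 2 = ‖T‖ := by
  rw [CFC.norm_sqrt _ (CFC.abs_nonneg T), Real.sq_sqrt (norm_nonneg _), CFC.norm_abs]

lemma norm_polarU_mul_sqrt_sq (T : C2 →L[ℂ] C2) :
    ‖polarU T * CFC.sqrt (CFC.abs T)‖ ^ 2 = ‖T‖ := by
  rw [polarU_mul_sqrt, norm_mul_eq_norm_abs_mul, abs_mul_cfc_abs, ← norm_sqrt_abs_sq T,
    sqrt_abs_eq_cfc]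
  congr 3
  ext t
  by_cases ht : t = 0
  · simp [ht]
  · rw [mul_inv_cancel_left₀ ht]

/-- The partial isometry `U` is discontinuous in `T`, but `U |T|^{1/2}` is a pointwise limit of
continuous functions of `T`. -/
lemma measurable_polarU_mul_sqrt :
    StronglyMeasurable fun T : C2 →L[ℂ] C2 => polarU T * CFC.sqrt (CFC.abs T) := by
  simp only [polarU_mul_sqrt]
  refine stronglyMeasurable_of_tendsto Filter.atTop
    (f := fun (n : ℕ) (T : C2 →L[ℂ] C2) =>
      T * cfc (fun t : ℝ => (|t| + 1 / ((n : ℝ) + 1))⁻¹ * √t) (CFC.abs T)) (fun n => ?_) ?_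
  · have hc : Continuous fun t : ℝ => (|t| + 1 / ((n : ℝ) + 1))⁻¹ * √t := by
      refine Continuous.mul (Continuous.inv₀ (by fun_prop) fun t => ?_) (by fun_prop)
      positivity
    refine (continuous_id.mul ?_).stronglyMeasurable
    exact Continuous.cfc_of_mem_nhdsSet (s := Set.univ) _ Filter.univ_mem
      CFC.continuous_abs isSelfAdjoint_abs hc.continuousOn
  · rw [tendsto_pi_nhds]
    intro T
    refine Filter.Tendsto.const_mul _ (tendsto_cfc_fun ?_ (Filter.Eventually.of_forall
      fun n => continuousOn_spectrum _ _))
    intro u hu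
    rw [Filter.eventually_all_finite (finite_spectrum _)]
    intro t ht
    have ht0 : 0 ≤ t := spectrum_nonneg_of_nonneg (CFC.abs_nonneg T) ht
    refine Filter.Tendsto.eventually (p := fun y => (t⁻¹ * √t, y) ∈ u) ?_ (mem_nhds_left _ hu)
    rcases ht0.eq_or_lt with rfl | ht1
    · simp
    · refine Filter.Tendsto.mul_const _ (Filter.Tendsto.inv₀ ?_ ht1.ne')
      simpa only [abs_of_pos ht1, add_zero] using
        (tendsto_one_div_add_atTop_nhds_zero_nat (𝕜 := ℝ)).const_add |t|

end Polar

/-! ### Integrability of the potential and of its factors -/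

section Potential

variable {V : ℝ → Matrix (Fin 2) (Fin 2) ℂ}

lemma toEuclideanCLM_eq_sum (M : Matrix (Fin 2) (Fin 2) ℂ) :
    Matrix.toEuclideanCLM (n := Fin 2) (𝕜 := ℂ) M = ∑ i, ∑ j,
      M i j • Matrix.toEuclideanCLM (n := Fin 2) (𝕜 := ℂ) (Matrix.single i j 1) := by
  conv_lhs => rw [Matrix.matrix_eq_sum_single M, map_sum]
  refine Finset.sum_congr rfl fun i _ => ?_
  rw [map_sum]
  refine Finset.sum_congr rfl fun j _ => ?_
  rw [← map_smul, Matrix.smul_single, smul_eq_mul, mul_one]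

lemma integrable_sum_smul {E : Type*} [NormedAddCommGroup E] [NormedSpace ℂ E]
    (hV : ∀ i j : Fin 2, Integrable (fun x : ℝ => V x i j)) (T : Fin 2 → Fin 2 → E) :
    Integrable fun x => ∑ i, ∑ j, V x i j • T i j :=
  integrable_finsetSum Finset.univ fun i _ =>
    integrable_finsetSum Finset.univ fun j _ => (hV i j).smul_const (T i j)

lemma integrable_potOp (hV : ∀ i j : Fin 2, Integrable (fun x : ℝ => V x i j)) :
    Integrable (potOp V) := by
  have h : potOp V = fun x => ∑ i, ∑ j,
      V x i j • Matrix.toEuclideanCLM (n := Fin 2) (𝕜 := ℂ) (Matrix.single i j 1) :=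
    funext fun x => toEuclideanCLM_eq_sum (V x)
  rw [h]
  exact integrable_sum_smul hV fun i j =>
    Matrix.toEuclideanCLM (n := Fin 2) (𝕜 := ℂ) (Matrix.single i j 1)

lemma factorB_mul_factorA (V : ℝ → Matrix (Fin 2) (Fin 2) ℂ) (x : ℝ) :
    factorB V x * factorA V x = potOp V x := by
  rw [factorA, factorB, mul_assoc, CFC.sqrt_mul_sqrt_self _ (CFC.abs_nonneg _), polarU_mul_abs]

lemma norm_factorA_sq (V : ℝ → Matrix (Fin 2) (Fin 2) ℂ) (x : ℝ) :
    ‖factorA V x‖ ^ 2 = ‖potOp V x‖ := norm_sqrt_abs_sq _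

lemma norm_factorB_sq (V : ℝ → Matrix (Fin 2) (Fin 2) ℂ) (x : ℝ) :
    ‖factorB V x‖ ^ 2 = ‖potOp V x‖ := norm_polarU_mul_sqrt_sq _

lemma aestronglyMeasurable_factorA (hV : ∀ i j : Fin 2, Integrable (fun x : ℝ => V x i j)) :
    AEStronglyMeasurable (factorA V) :=
  continuous_sqrt_abs.comp_aestronglyMeasurable (integrable_potOp hV).1

lemma aestronglyMeasurable_factorB (hV : ∀ i j : Fin 2, Integrable (fun x : ℝ => V x i j)) :
    AEStronglyMeasurable (factorB V) := by
  borelize (C2 →L[ℂ] C2)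
  exact (measurable_polarU_mul_sqrt.measurable.comp_aemeasurable
    (integrable_potOp hV).1.aemeasurable).aestronglyMeasurable

lemma lintegral_enorm_potOp (hV : ∀ i j : Fin 2, Integrable (fun x : ℝ => V x i j)) :
    ∫⁻ x, ‖potOp V x‖ₑ = ENNReal.ofReal (potNorm V) := by
  rw [potNorm, integral_norm_eq_lintegral_enorm (integrable_potOp hV).1,
    ENNReal.ofReal_toReal (integrable_potOp hV).2.ne]

lemma lintegral_enorm_factorA_sq (hV : ∀ i j : Fin 2, Integrable (fun x : ℝ => V x i j)) :
    ∫⁻ x, ‖factorA V x‖ₑ ^ 2 = ENNReal.ofReal (potNorm V) := by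
  rw [← lintegral_enorm_potOp hV]
  congr 1 with x
  rw [← enorm_norm (potOp V x), ← norm_factorA_sq, enorm_pow, enorm_norm]

lemma lintegral_enorm_factorB_sq (hV : ∀ i j : Fin 2, Integrable (fun x : ℝ => V x i j)) :
    ∫⁻ x, ‖factorB V x‖ₑ ^ 2 = ENNReal.ofReal (potNorm V) := by
  rw [← lintegral_enorm_potOp hV]
  congr 1 with x
  rw [← enorm_norm (potOp V x), ← norm_factorB_sq, enorm_pow, enorm_norm]

end Potential

/-! ### Maximal multiplication operators -/

section Multiplication

variable {M : ℝ → C2 →L[ℂ] C2}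

lemma mulOp_coeFn (f : (mulOp M).domain) : mulOp M f =ᵐ[volume] fun x => M x ((f : L2) x) :=
  MemLp.coeFn_toLp f.2

lemma aestronglyMeasurable_apply (hM : AEStronglyMeasurable M) (f : L2) :
    AEStronglyMeasurable (fun x => M x (f x)) :=
  (ContinuousLinearMap.apply ℂ C2).aestronglyMeasurable_comp₂ (Lp.aestronglyMeasurable f) hM

/-- Convergence in `L²` implies convergence almost everywhere along a subsequence. -/
lemma mulOp_isClosed : (mulOp M).IsClosed := by
  refine IsSeqClosed.isClosed ?_
  rintro u ⟨f, g⟩ hu hlim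
  have hf : Filter.Tendsto (fun n => (u n).1) Filter.atTop (nhds f) :=
    (continuous_fst.tendsto _).comp hlim
  have hg : Filter.Tendsto (fun n => (u n).2) Filter.atTop (nhds g) :=
    (continuous_snd.tendsto _).comp hlim
  obtain ⟨φ, hφ, hfφ⟩ := (tendstoInMeasure_of_tendsto_Lp hf).exists_seq_tendsto_ae
  obtain ⟨ψ, hψ, hgψ⟩ := (tendstoInMeasure_of_tendsto_Lp
    (hg.comp hφ.tendsto_atTop)).exists_seq_tendsto_ae
  have hMu : ∀ n, (u n).2 =ᵐ[volume] fun x => M x ((u n).1 x) := by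
    intro n
    obtain ⟨y, hy1, hy2⟩ := LinearPMap.mem_graph_iff _ |>.1 (hu n)
    rw [← hy1, ← hy2]
    exact mulOp_coeFn y
  have key : g =ᵐ[volume] fun x => M x (f x) := by
    filter_upwards [hfφ, hgψ, ae_all_iff.2 hMu] with x h1 h2 h3
    refine tendsto_nhds_unique h2 ?_
    simp only [Function.comp, h3]
    exact ((M x).continuous.tendsto _).comp (h1.comp hψ.tendsto_atTop)
  have hm : f ∈ (mulOp M).domain := (memLp_congr_ae key).1 (Lp.memLp g)
  refine LinearPMap.mem_graph_iff _ |>.2 ⟨⟨f, hm⟩, rfl, ?_⟩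
  exact Lp.ext ((mulOp_coeFn _).trans key.symm)

/-- If `g` is orthogonal to the domain, then it is orthogonal to `(1 + ‖M‖)⁻¹ g`, which belongs
to the domain. -/
lemma dense_mulOp_domain (hM : AEStronglyMeasurable M) :
    Dense ((mulOp M).domain : Set L2) := by
  rw [Submodule.dense_iff_topologicalClosure_eq_top, Submodule.topologicalClosure_eq_top_iff,
    Submodule.eq_bot_iff]
  intro g hg
  have hpos : ∀ x, 0 < 1 + ‖M x‖ := fun x => by positivity
  have hmeas : AEStronglyMeasurable (fun x => ((1 + ‖M x‖)⁻¹ : ℝ) • g x) :=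
    ((aemeasurable_const.add hM.norm.aemeasurable).inv.aestronglyMeasurable).smul
      (Lp.aestronglyMeasurable g)
  have hf : MemLp (fun x => ((1 + ‖M x‖)⁻¹ : ℝ) • g x) 2 (volume : Measure ℝ) := by
    refine (Lp.memLp g).of_le hmeas (Filter.Eventually.of_forall fun x => ?_)
    rw [norm_smul, Real.norm_of_nonneg (inv_nonneg.2 (hpos x).le)]
    refine mul_le_of_le_one_left (norm_nonneg _) (inv_le_one_of_one_le₀ ?_)
    linarith [norm_nonneg (M x)]
  have hmem : hf.toLp ∈ (mulOp M).domain := by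
    refine (Lp.memLp g).of_le (aestronglyMeasurable_apply hM _) ?_
    filter_upwards [hf.coeFn_toLp] with x hx
    refine ((M x).le_opNorm _).trans ?_
    rw [hx, norm_smul, Real.norm_of_nonneg (inv_nonneg.2 (hpos x).le), ← mul_assoc]
    refine mul_le_of_le_one_left (norm_nonneg _) ?_
    rw [← div_eq_mul_inv, div_le_one (hpos x)]
    linarith
  have h0 := (Submodule.mem_orthogonal _ g).1 hg _ hmem
  have h1 : ∫ x, (1 + ‖M x‖)⁻¹ * ‖g x‖ ^ 2 = 0 := by
    rw [L2.inner_def] at h0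
    have : ∫ x, (((1 + ‖M x‖)⁻¹ * ‖g x‖ ^ 2 : ℝ) : ℂ) = 0 := by
      rw [← h0]
      refine integral_congr_ae ?_
      filter_upwards [hf.coeFn_toLp] with x hx
      rw [hx, inner_smul_left_eq_smul, inner_self_eq_norm_sq_to_K]
      simp
    rw [integral_complex_ofReal] at this
    exact_mod_cast this
  have h2 : Integrable fun x => (1 + ‖M x‖)⁻¹ * ‖g x‖ ^ 2 := by
    refine ((memLp_two_iff_integrable_sq_norm (Lp.aestronglyMeasurable g)).1 (Lp.memLp g)).mono'
      ((aemeasurable_const.add hM.norm.aemeasurable).inv.mul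
        ((Lp.aestronglyMeasurable g).norm.aemeasurable.pow_const 2)).aestronglyMeasurable
      (Filter.Eventually.of_forall fun x => ?_)
    rw [Real.norm_of_nonneg (mul_nonneg (inv_nonneg.2 (hpos x).le) (sq_nonneg _))]
    refine mul_le_of_le_one_left (sq_nonneg _) (inv_le_one_of_one_le₀ ?_)
    linarith [norm_nonneg (M x)]
  rw [integral_eq_zero_iff_of_nonneg
    (fun x => mul_nonneg (inv_nonneg.2 (hpos x).le) (sq_nonneg _)) h2] at h1
  refine Lp.ext ?_
  filter_upwards [h1, Lp.coeFn_zero C2 2 (volume : Measure ℝ)] with x hx hx0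
  have := (hpos x).ne'
  rw [hx0]
  simpa [this] using hx

end Multiplication

/-! ### Variation of constants with locally integrable data -/

section VariationOfConstants

lemma intervalIntegrable_of_locallyIntegrable {E : Type*} [NormedAddCommGroup E] {u : ℝ → E}
    (hu : LocallyIntegrable u) (a b : ℝ) : IntervalIntegrable u volume a b :=
  (hu.integrableOn_isCompact isCompact_uIcc).intervalIntegrable

/-- The vector-valued case follows from the one of the scalar function `‖u‖`. -/
lemma absolutelyContinuousOnInterval_integral {E : Type*} [NormedAddCommGroup E]
    [NormedSpace ℝ E] {u : ℝ → E} (hu : LocallyIntegrable u)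
    (a b : ℝ) : AbsolutelyContinuousOnInterval (fun x => ∫ t in a..x, u t) a b := by
  have hn : LocallyIntegrable fun t => ‖u t‖ := fun x => by
    obtain ⟨s, hs, hi⟩ := hu x
    exact ⟨s, hs, hi.norm⟩
  have h := (intervalIntegrable_of_locallyIntegrable hn a b
    ).absolutelyContinuousOnInterval_intervalIntegral (c := a) Set.left_mem_uIcc
  refine squeeze_zero (fun _ => Finset.sum_nonneg fun _ _ => dist_nonneg)
    (fun I => Finset.sum_le_sum fun i _ => ?_) h
  rw [dist_comm, dist_comm (∫ t in a..(I.2 i).1, ‖u t‖), dist_eq_norm, dist_eq_norm,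
    intervalIntegral.integral_interval_sub_left (intervalIntegrable_of_locallyIntegrable hu _ _)
      (intervalIntegrable_of_locallyIntegrable hu _ _),
    intervalIntegral.integral_interval_sub_left (intervalIntegrable_of_locallyIntegrable hn _ _)
      (intervalIntegrable_of_locallyIntegrable hn _ _)]
  exact intervalIntegral.norm_integral_le_abs_integral_norm

/-- Variation of constants: the function `F(x) = e^{μx} (K + ∫₀ˣ e^{-μt} u(t) dt)` solves the
equation `F' = μ F + u` in integrated form. -/
lemma variation_of_constants (μ : ℂ) {u : ℝ → C2} (hu : LocallyIntegrable u) (K : C2) (x : ℝ) :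
    Complex.exp (μ * x) • (K + ∫ t in (0 : ℝ)..x, Complex.exp (-μ * t) • u t)
      = K + ∫ t in (0 : ℝ)..x,
        (μ • (Complex.exp (μ * t) • (K + ∫ s in (0 : ℝ)..t, Complex.exp (-μ * s) • u s)) + u t) := by
  set P : ℝ → C2 := fun t => K + ∫ s in (0 : ℝ)..t, Complex.exp (-μ * s) • u s with hP
  set F : ℝ → C2 := fun t => Complex.exp (μ * t) • P t with hF
  have hw : LocallyIntegrable fun t : ℝ => Complex.exp (-μ * t) • u t :=
    LocallyIntegrable.continuous_smul (g := fun t : ℝ => Complex.exp (-μ * t)) (by fun_prop) hu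
  have hPc : Continuous P := continuous_const.add
    (intervalIntegral.continuous_primitive (intervalIntegrable_of_locallyIntegrable hw) 0)
  have hexpc : Continuous fun t : ℝ => Complex.exp (μ * t) := by fun_prop
  have hFc : Continuous F := hexpc.smul hPc
  have hv : LocallyIntegrable fun t : ℝ => μ • F t + u t :=
    (hFc.const_smul μ).locallyIntegrable.add hu
  have hexp : ContDiff ℝ 1 fun t : ℝ => Complex.exp (μ * t) := by
    have : ContDiff ℝ 1 fun t : ℝ => (t : ℂ) := Complex.ofRealCLM.contDiff
    exact (contDiff_const.mul this).cexp
  have hPac : AbsolutelyContinuousOnInterval P 0 x :=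
    AbsolutelyContinuousOnInterval.fun_add (f := fun _ => K)
      (contDiff_const.contDiffOn.absolutelyContinuousOnInterval)
      (absolutelyContinuousOnInterval_integral hw 0 x)
  have hFac : AbsolutelyContinuousOnInterval F 0 x :=
    AbsolutelyContinuousOnInterval.fun_smul
      (hexp.contDiffOn.absolutelyContinuousOnInterval) hPac
  have hac : AbsolutelyContinuousOnInterval (fun t => F t - ∫ s in (0 : ℝ)..t, (μ • F s + u s))
      0 x := hFac.fun_sub (absolutelyContinuousOnInterval_integral hv 0 x)
  obtain ⟨C, hC⟩ := hac.const_of_ae_hasDerivAt_zero (by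
    filter_upwards [LocallyIntegrable.ae_hasDerivAt_integral hw,
      LocallyIntegrable.ae_hasDerivAt_integral hv] with t h1 h2 _
    have h3 : HasDerivAt (fun s : ℝ => Complex.exp (μ * s)) (Complex.exp (μ * t) * μ) t := by
      have h4 : HasDerivAt (fun s : ℝ => μ * (s : ℂ)) (μ * 1) t :=
        (Complex.ofRealCLM.hasDerivAt (x := t)).const_mul μ
      simpa using h4.cexp
    have h5 := (h3.smul ((h1 0).const_add K)).sub (h2 0)
    convert! h5 using 1
    have h6 : Complex.exp (μ * t) • Complex.exp (-μ * t) • u t = u t := by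
      rw [smul_smul, ← Complex.exp_add]; simp
    rw [h6]
    change 0 = u t + (Complex.exp (μ * t) * μ) • P t - (μ • Complex.exp (μ * t) • P t + u t)
    module)
  have h0 := hC 0 Set.left_mem_uIcc
  have h1 := hC x Set.right_mem_uIcc
  simp only [intervalIntegral.integral_same, sub_zero] at h0
  rw [← h0, sub_eq_iff_eq_add] at h1
  change F x = _
  rw [h1]
  simp [hF, hP]

end VariationOfConstants

/-! ### The inequalities of Cauchy–Schwarz and Young -/

section CauchySchwarz

lemma lintegral_mul_sq_le {f g : ℝ → ENNReal} (hf : AEMeasurable f) (hg : AEMeasurable g) :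
    (∫⁻ x, f x * g x) ^ 2 ≤ (∫⁻ x, f x ^ 2) * ∫⁻ x, g x ^ 2 := by
  have h := ENNReal.lintegral_mul_le_Lp_mul_Lq volume Real.HolderConjugate.two_two hf hg
  have h2 := pow_le_pow_left' h 2
  rw [mul_pow, ← ENNReal.rpow_mul_natCast, ← ENNReal.rpow_mul_natCast] at h2
  simpa using h2

/-- The Cauchy–Schwarz inequality with respect to the measure `h(x) dx`. -/
lemma lintegral_mul_sq_le_weighted {f h : ℝ → ENNReal} (hf : AEMeasurable f)
    (hh : AEMeasurable h) :
    (∫⁻ x, f x * h x) ^ 2 ≤ (∫⁻ x, h x) * ∫⁻ x, f x ^ 2 * h x := by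
  have h1 : ∀ x, h x = (h x ^ (1 / 2 : ℝ)) ^ 2 := fun x => by
    rw [← ENNReal.rpow_mul_natCast]; simp
  have h2 := lintegral_mul_sq_le (f := fun x => h x ^ (1 / 2 : ℝ))
    (g := fun x => f x * h x ^ (1 / 2 : ℝ)) (hh.pow_const _) (hf.mul (hh.pow_const _))
  have h3 : ∀ x, h x ^ (1 / 2 : ℝ) * (f x * h x ^ (1 / 2 : ℝ)) = f x * h x := fun x => by
    conv_rhs => rw [h1 x]
    ring
  simpa only [h3, mul_pow, ← h1] using h2

variable {φ u : ℝ → ENNReal}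

lemma lintegral_convolution (hφ : Measurable φ) (hu : AEMeasurable u) :
    ∫⁻ x, ∫⁻ y, φ (x - y) * u y = (∫⁻ x, φ x) * ∫⁻ y, u y := by
  rw [lintegral_lintegral_swap]
  · rw [← lintegral_const_mul'' _ hu]
    refine lintegral_congr fun y => ?_
    rw [← lintegral_sub_right_eq_self φ y]
    exact lintegral_mul_const _ (hφ.comp (measurable_sub_const y))
  · exact (hφ.comp (measurable_fst.sub measurable_snd)).aemeasurable.mul hu.comp_snd

/-- Young's inequality `‖φ * u‖₂ ≤ ‖φ‖₁ ‖u‖₂`. -/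
lemma lintegral_convolution_sq_le_one_two (hφ : Measurable φ) (hu : AEMeasurable u) :
    ∫⁻ x, (∫⁻ y, φ (x - y) * u y) ^ 2 ≤ (∫⁻ x, φ x) ^ 2 * ∫⁻ y, u y ^ 2 := by
  calc ∫⁻ x, (∫⁻ y, φ (x - y) * u y) ^ 2
      ≤ ∫⁻ x, (∫⁻ x, φ x) * ∫⁻ y, φ (x - y) * u y ^ 2 := by
        refine lintegral_mono fun x => ?_
        have := lintegral_mul_sq_le_weighted hu
          ((hφ.comp (measurable_const_sub x)).aemeasurable (μ := volume))
        simp only [Function.comp_def, lintegral_sub_left_eq_self φ] at this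
        simpa only [mul_comm] using this
    _ ≤ _ := by
        rw [lintegral_const_mul'', lintegral_convolution hφ (hu.pow_const 2), sq, mul_assoc]
        exact ((hφ.comp (measurable_fst.sub measurable_snd)).aemeasurable.mul
          (hu.pow_const 2).comp_snd).lintegral_prod_right'

/-- Young's inequality `‖φ * u‖₂ ≤ ‖φ‖₂ ‖u‖₁`. -/
lemma lintegral_convolution_sq_le_two_one (hφ : Measurable φ) (hu : AEMeasurable u) :
    ∫⁻ x, (∫⁻ y, φ (x - y) * u y) ^ 2 ≤ (∫⁻ x, φ x ^ 2) * (∫⁻ y, u y) ^ 2 := by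
  calc ∫⁻ x, (∫⁻ y, φ (x - y) * u y) ^ 2
      ≤ ∫⁻ x, (∫⁻ y, u y) * ∫⁻ y, φ (x - y) ^ 2 * u y := by
        refine lintegral_mono fun x => ?_
        exact lintegral_mul_sq_le_weighted
          ((hφ.comp (measurable_const_sub x)).aemeasurable (μ := volume)) hu
    _ ≤ _ := by
        rw [lintegral_const_mul'', lintegral_convolution (φ := fun t => φ t ^ 2)
          (hφ.pow_const 2) hu, sq, ← mul_assoc, ← mul_assoc, mul_comm (∫⁻ y, u y)]
        exact (((hφ.pow_const 2).comp (measurable_fst.sub measurable_snd)).aemeasurable.mul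
          hu.comp_snd).lintegral_prod_right'

/-- Young's inequality `‖φ * u‖_∞ ≤ ‖φ‖₂ ‖u‖₂`. -/
lemma convolution_sq_le_two_two (hφ : Measurable φ) (hu : AEMeasurable u) (x : ℝ) :
    (∫⁻ y, φ (x - y) * u y) ^ 2 ≤ (∫⁻ x, φ x ^ 2) * ∫⁻ y, u y ^ 2 := by
  have := lintegral_mul_sq_le ((hφ.comp (measurable_const_sub x)).aemeasurable (μ := volume)) hu
  simp only [Function.comp_def, lintegral_sub_left_eq_self fun t => φ t ^ 2] at this
  exact this

end CauchySchwarz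

/-! ### The free Dirac operator -/

section DerivOp

lemma hasL2Deriv_iff {f g : L2} :
    HasL2Deriv f g ↔ ∃ h : f ∈ derivOp.domain, derivOp ⟨f, h⟩ = g := by
  have hgraph : derivOp.graph = derivGraph :=
    Submodule.toLinearPMap_graph_eq _ derivGraph_functional
  have h1 : HasL2Deriv f g ↔ (f, g) ∈ derivOp.graph := by
    rw [hgraph]
    rfl
  rw [h1, LinearPMap.mem_graph_iff]
  constructor
  · rintro ⟨y, rfl, rfl⟩
    exact ⟨y.2, rfl⟩
  · rintro ⟨h, rfl⟩
    exact ⟨⟨f, h⟩, rfl, rfl⟩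

/-- The action of `H₀` in terms of the derivative. -/
lemma freeDirac_coeFn (m : ℝ) {f g : L2} (hfg : HasL2Deriv f g)
    (h : f ∈ (freeDirac m).domain) :
    freeDirac m ⟨f, h⟩ =ᵐ[volume]
      fun x => (-Complex.I) • sigma1 (g x) + (m : ℂ) • sigma3 (f x) := by
  obtain ⟨h', rfl⟩ := hasL2Deriv_iff.1 hfg
  have h1 : freeDirac m ⟨f, h⟩ = (-Complex.I) • sigma1.compLpL 2 volume (derivOp ⟨f, h'⟩)
    + (m : ℂ) • sigma3.compLpL 2 volume f := rfl
  rw [h1]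
  filter_upwards [Lp.coeFn_add ((-Complex.I) • sigma1.compLpL 2 volume (derivOp ⟨f, h'⟩))
    ((m : ℂ) • sigma3.compLpL 2 volume f),
    Lp.coeFn_smul (-Complex.I) (sigma1.compLpL 2 volume (derivOp ⟨f, h'⟩)),
    Lp.coeFn_smul (m : ℂ) (sigma3.compLpL 2 volume f),
    sigma1.coeFn_compLpL (p := 2) (μ := volume) (derivOp ⟨f, h'⟩),
    sigma3.coeFn_compLpL (p := 2) (μ := volume) f] with x h2 h3 h4 h5 h6
  rw [h2, Pi.add_apply, h3, h4, Pi.smul_apply, Pi.smul_apply, h5, h6]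

lemma mem_freeDirac_domain (m : ℝ) {f g : L2} (hfg : HasL2Deriv f g) :
    f ∈ (freeDirac m).domain := (hasL2Deriv_iff.1 hfg).1

lemma exists_hasL2Deriv {m : ℝ} (f : (freeDirac m).domain) : ∃ g, HasL2Deriv (f : L2) g :=
  ⟨_, hasL2Deriv_iff.2 ⟨f.2, rfl⟩⟩

end DerivOp

/-! ### The coefficient matrices of the free resolvent -/

section Coefficients

variable (m : ℝ) (z k : ℂ)

/-- The coefficient matrix `N` of the equation `(H₀ - z) f = 0`, written as `f' = N f`. -/
def coeffN : C2 →L[ℂ] C2 := Matrix.toEuclideanCLM (n := Fin 2) (𝕜 := ℂ)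
  !![0, Complex.I * (z + m); Complex.I * (z - m), 0]

/-- The coefficient, for the sign `s = ±1` of `x - y`, of the resolvent kernel
`e^{ik|x-y|} kernelCoeff m z k s` of the free Dirac operator at `z`, where `k² = z² - m²`. -/
def kernelCoeff (s : ℂ) : C2 →L[ℂ] C2 := Matrix.toEuclideanCLM (n := Fin 2) (𝕜 := ℂ)
  !![Complex.I / 2 * ((z + m) / k), Complex.I / 2 * s;
    Complex.I / 2 * s, Complex.I / 2 * ((z - m) / k)]

variable {m z k}

lemma ext_C2 {v w : C2} (h0 : v 0 = w 0) (h1 : v 1 = w 1) : v = w := by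
  ext i
  fin_cases i
  · exact h0
  · exact h1

lemma toEuclideanCLM_apply_zero (a b c d : ℂ) (v : C2) :
    Matrix.toEuclideanCLM (n := Fin 2) (𝕜 := ℂ) !![a, b; c, d] v 0 = a * v 0 + b * v 1 := by
  rw [Matrix.ofLp_toEuclideanCLM, Matrix.mulVec_apply_eq_sum]
  simp

lemma toEuclideanCLM_apply_one (a b c d : ℂ) (v : C2) :
    Matrix.toEuclideanCLM (n := Fin 2) (𝕜 := ℂ) !![a, b; c, d] v 1 = c * v 0 + d * v 1 := by
  rw [Matrix.ofLp_toEuclideanCLM, Matrix.mulVec_apply_eq_sum]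
  simp

lemma coeffN_coeffN (hk : k ^ 2 = z ^ 2 - m ^ 2) (v : C2) :
    coeffN m z (coeffN m z v) = (Complex.I * k) ^ 2 • v := by
  refine ext_C2 ?_ ?_ <;>
  simp only [coeffN, toEuclideanCLM_apply_zero, toEuclideanCLM_apply_one, PiLp.smul_apply,
    smul_eq_mul, mul_pow, hk] <;> ring

lemma coeffN_kernelCoeff (hk : k ^ 2 = z ^ 2 - m ^ 2) (hk0 : k ≠ 0) (s : ℂ) (hs : s * s = 1)
    (v : C2) :
    coeffN m z (kernelCoeff m z k s v) = (s * (Complex.I * k)) • kernelCoeff m z k s v := by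
  have h2 : (z + m) * ((z - m) / k) = k := by
    rw [mul_div_assoc', div_eq_iff hk0]; linear_combination -hk
  have h3 : (z - m) * ((z + m) / k) = k := by
    rw [mul_div_assoc', div_eq_iff hk0]; linear_combination -hk
  have h4 : k * ((z + m) / k) = z + m := mul_div_cancel₀ _ hk0
  have h5 : k * ((z - m) / k) = z - m := mul_div_cancel₀ _ hk0
  refine ext_C2 ?_ ?_ <;>
  simp only [coeffN, kernelCoeff, toEuclideanCLM_apply_zero, toEuclideanCLM_apply_one,
    PiLp.smul_apply, smul_eq_mul]
  · generalize (z + m) / k = a at *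
    generalize (z - m) / k = b at *
    linear_combination (Complex.I ^ 2 / 2) * (v 1 * h2 - s * v 0 * h4 - k * v 1 * hs)
  · generalize (z + m) / k = a at *
    generalize (z - m) / k = b at *
    linear_combination (Complex.I ^ 2 / 2) * (v 0 * h3 - s * v 1 * h5 - k * v 0 * hs)

/-- The jump of the resolvent kernel on the diagonal. -/
lemma kernelCoeff_sub (v : C2) :
    kernelCoeff m z k 1 v - kernelCoeff m z k (-1) v = Complex.I • sigma1 v := by
  refine ext_C2 ?_ ?_ <;>
  simp only [sigma1, kernelCoeff, toEuclideanCLM_apply_zero, toEuclideanCLM_apply_one,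
    PiLp.smul_apply, PiLp.sub_apply, smul_eq_mul] <;> ring

/-- If `f' = N f + i σ₁ g`, then `H₀ f = z f + g`. -/
lemma dirac_coeffN (v w : C2) :
    (-Complex.I) • sigma1 (coeffN m z v + Complex.I • sigma1 w) + (m : ℂ) • sigma3 v
      = z • v + w := by
  refine ext_C2 ?_ ?_ <;>
  simp only [sigma1, sigma3, coeffN, toEuclideanCLM_apply_zero, toEuclideanCLM_apply_one,
    PiLp.smul_apply, PiLp.add_apply, smul_eq_mul] <;> ring_nf <;> simp only [Complex.I_sq] <;> ring

/-- If `H₀ f = z f`, then `f' = N f`. -/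
lemma eq_coeffN_of_dirac {v w : C2}
    (h : (-Complex.I) • sigma1 w + (m : ℂ) • sigma3 v = z • v) : w = coeffN m z v := by
  have h0 := congrArg (fun u : C2 => u 0) h
  have h1 := congrArg (fun u : C2 => u 1) h
  simp only [sigma1, sigma3, toEuclideanCLM_apply_zero, toEuclideanCLM_apply_one,
    PiLp.smul_apply, PiLp.add_apply, smul_eq_mul] at h0 h1
  refine ext_C2 ?_ ?_ <;>
  simp only [coeffN, toEuclideanCLM_apply_zero, toEuclideanCLM_apply_one]
  · linear_combination Complex.I * h1 + w 0 * Complex.I_sq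
  · linear_combination Complex.I * h0 + w 1 * Complex.I_sq

/-- The bound is the Hilbert–Schmidt norm, since `|(z + m) / k| |(z - m) / k| = 1`. Nothing is lost for
`s = ±1`, where the matrix has rank one. -/
lemma norm_kernelCoeff_le (hk : k ^ 2 = z ^ 2 - m ^ 2) (hk0 : k ≠ 0) (s : ℂ) (hs : ‖s‖ = 1) :
    ‖kernelCoeff m z k s‖ ≤ (‖z + m‖ + ‖z - m‖) / (2 * ‖k‖) := by
  refine ContinuousLinearMap.opNorm_le_bound _ (by positivity) fun v => ?_
  have hkpos : 0 < ‖k‖ := norm_pos_iff.2 hk0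
  have h1 : ‖z + m‖ * ‖z - m‖ = ‖k‖ ^ 2 := by
    rw [← norm_mul, ← norm_pow, hk]; congr 1; ring
  have ha : ‖(z + m) / k‖ = ‖z + m‖ / ‖k‖ := norm_div _ _
  have hb : ‖(z - m) / k‖ = ‖z - m‖ / ‖k‖ := norm_div _ _
  have hab : ‖(z + m) / k‖ * ‖(z - m) / k‖ = 1 := by
    rw [ha, hb, div_mul_div_comm, h1]; field_simp
  have hc : (‖z + m‖ + ‖z - m‖) / (2 * ‖k‖) = (‖(z + m) / k‖ + ‖(z - m) / k‖) / 2 := by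
    rw [ha, hb]; field_simp
  rw [hc]
  set a := (z + m) / k
  set b := (z - m) / k
  rw [EuclideanSpace.norm_eq, EuclideanSpace.norm_eq]
  refine Real.sqrt_le_iff.2 ⟨by positivity, ?_⟩
  rw [mul_pow, Real.sq_sqrt (by positivity), Fin.sum_univ_two, Fin.sum_univ_two]
  simp only [kernelCoeff, toEuclideanCLM_apply_zero, toEuclideanCLM_apply_one]
  have e0 : ‖Complex.I / 2 * a * v 0 + Complex.I / 2 * s * v 1‖
      ≤ (‖a‖ * ‖v 0‖ + ‖v 1‖) / 2 := by
    refine (norm_add_le _ _).trans (le_of_eq ?_)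
    simp only [norm_mul, norm_div, Complex.norm_I, hs, RCLike.norm_ofNat]
    ring
  have e1 : ‖Complex.I / 2 * s * v 0 + Complex.I / 2 * b * v 1‖
      ≤ (‖v 0‖ + ‖b‖ * ‖v 1‖) / 2 := by
    refine (norm_add_le _ _).trans (le_of_eq ?_)
    simp only [norm_mul, norm_div, Complex.norm_I, hs, RCLike.norm_ofNat]
    ring
  have f0 := pow_le_pow_left₀ (norm_nonneg _) e0 2
  have f1 := pow_le_pow_left₀ (norm_nonneg _) e1 2
  refine (add_le_add f0 f1).trans ?_
  nlinarith [sq_nonneg (‖a‖ * ‖v 1‖ - ‖v 0‖), sq_nonneg (‖b‖ * ‖v 0‖ - ‖v 1‖), hab]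

end Coefficients

/-! ### Exponential integral operators -/

section ExpIntegrals

variable {μ : ℂ}

/-- The solution `x ↦ ∫_{y<x} e^{μ(x-y)} u(y) dy` of `f' = μ f + u`. -/
def leftInt (μ : ℂ) (u : ℝ → C2) (x : ℝ) : C2 :=
  Complex.exp (μ * x) • ∫ y in Set.Iic x, Complex.exp (-μ * y) • u y

/-- The solution `x ↦ ∫_{y>x} e^{μ(y-x)} u(y) dy` of `f' = -μ f - u`. -/
def rightInt (μ : ℂ) (u : ℝ → C2) (x : ℝ) : C2 :=
  Complex.exp (-μ * x) • ∫ y in Set.Ioi x, Complex.exp (μ * y) • u y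

lemma integrableOn_exp_smul {ν : ℂ} {s : Set ℝ}
    (hν : IntegrableOn (fun y : ℝ => Real.exp (2 * ν.re * y)) s) {u : ℝ → C2}
    (hu : MemLp u 2 volume) : IntegrableOn (fun y : ℝ => Complex.exp (ν * y) • u y) s := by
  have h : MemLp (fun y : ℝ => Complex.exp (ν * y)) 2 (volume.restrict s) := by
    have hc : Continuous fun y : ℝ => Complex.exp (ν * y) := by fun_prop
    rw [memLp_two_iff_integrable_sq_norm hc.aestronglyMeasurable]
    refine hν.congr (Filter.Eventually.of_forall fun y => ?_)
    simp only [Complex.norm_exp, ← Real.exp_nat_mul]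
    congr 1
    simp; ring
  have := (hu.restrict s).smul h (r := 1)
  rwa [memLp_one_iff_integrable] at this

lemma integrableOn_Iic_exp_smul (hμ : μ.re < 0) {u : ℝ → C2} (hu : MemLp u 2 volume) (x : ℝ) :
    IntegrableOn (fun y : ℝ => Complex.exp (-μ * y) • u y) (Set.Iic x) :=
  integrableOn_exp_smul (integrableOn_exp_mul_Iic (by rw [Complex.neg_re]; linarith) x) hu

lemma integrableOn_Ioi_exp_smul (hμ : μ.re < 0) {u : ℝ → C2} (hu : MemLp u 2 volume) (x : ℝ) :
    IntegrableOn (fun y : ℝ => Complex.exp (μ * y) • u y) (Set.Ioi x) :=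
  integrableOn_exp_smul (integrableOn_exp_mul_Ioi (by linarith) x) hu

lemma leftInt_eq (hμ : μ.re < 0) {u : ℝ → C2} (hu : MemLp u 2 volume) (x : ℝ) :
    leftInt μ u x = Complex.exp (μ * x) • ((∫ y in Set.Iic (0 : ℝ), Complex.exp (-μ * y) • u y)
      + ∫ t in (0 : ℝ)..x, Complex.exp (-μ * t) • u t) := by
  rw [leftInt, ← intervalIntegral.integral_Iic_sub_Iic (integrableOn_Iic_exp_smul hμ hu 0)
    (integrableOn_Iic_exp_smul hμ hu x), add_sub_cancel]

lemma rightInt_eq (hμ : μ.re < 0) {u : ℝ → C2} (hu : MemLp u 2 volume) (x : ℝ) :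
    rightInt μ u x = Complex.exp (-μ * x) •
      ((∫ y in Set.Ioi (0 : ℝ), Complex.exp (μ * y) • u y)
      + ∫ t in (0 : ℝ)..x, Complex.exp (-(-μ) * t) • (-u t)) := by
  have h := intervalIntegral.integral_interval_add_Ioi (integrableOn_Ioi_exp_smul hμ hu 0)
    (integrableOn_Ioi_exp_smul hμ hu x)
  rw [rightInt, ← h]
  simp

lemma continuous_leftInt (hμ : μ.re < 0) {u : ℝ → C2} (hu : MemLp u 2 volume) :
    Continuous (leftInt μ u) := by
  have hw : LocallyIntegrable fun t : ℝ => Complex.exp (-μ * t) • u t :=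
    LocallyIntegrable.continuous_smul (g := fun t : ℝ => Complex.exp (-μ * t)) (by fun_prop)
      (hu.locallyIntegrable (by norm_num))
  rw [funext (leftInt_eq hμ hu)]
  have hc : Continuous fun x : ℝ => Complex.exp (μ * x) := by fun_prop
  exact hc.smul (continuous_const.add
    (intervalIntegral.continuous_primitive (intervalIntegrable_of_locallyIntegrable hw) 0))

lemma continuous_rightInt (hμ : μ.re < 0) {u : ℝ → C2} (hu : MemLp u 2 volume) :
    Continuous (rightInt μ u) := by
  have hw : LocallyIntegrable fun t : ℝ => Complex.exp (-(-μ) * t) • (-u t) :=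
    LocallyIntegrable.continuous_smul (g := fun t : ℝ => Complex.exp (-(-μ) * t)) (by fun_prop)
      (hu.neg.locallyIntegrable (by norm_num))
  rw [funext (rightInt_eq hμ hu)]
  have hc : Continuous fun x : ℝ => Complex.exp (-μ * x) := by fun_prop
  exact hc.smul (continuous_const.add
    (intervalIntegral.continuous_primitive (intervalIntegrable_of_locallyIntegrable hw) 0))

lemma leftInt_integral (hμ : μ.re < 0) {u : ℝ → C2} (hu : MemLp u 2 volume) (x : ℝ) :
    leftInt μ u x = leftInt μ u 0 + ∫ t in (0 : ℝ)..x, (μ • leftInt μ u t + u t) := by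
  rw [leftInt_eq hμ hu, leftInt_eq hμ hu 0,
    variation_of_constants μ (hu.locallyIntegrable (by norm_num))]
  simp [leftInt_eq hμ hu]

lemma rightInt_integral (hμ : μ.re < 0) {u : ℝ → C2} (hu : MemLp u 2 volume) (x : ℝ) :
    rightInt μ u x = rightInt μ u 0 + ∫ t in (0 : ℝ)..x, (-μ • rightInt μ u t - u t) := by
  rw [rightInt_eq hμ hu, rightInt_eq hμ hu 0,
    variation_of_constants (-μ) (u := fun t => -u t) (hu.neg.locallyIntegrable (by norm_num))]
  simp [rightInt_eq hμ hu, sub_eq_add_neg]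

lemma enorm_leftInt_le (μ : ℂ) (u : ℝ → C2) (x : ℝ) :
    ‖leftInt μ u x‖ₑ
      ≤ ∫⁻ y in Set.Iic x, ENNReal.ofReal (Real.exp (μ.re * |x - y|)) * ‖u y‖ₑ := by
  rw [leftInt, ← integral_smul]
  refine (enorm_integral_le_lintegral_enorm _).trans ?_
  refine setLIntegral_mono' measurableSet_Iic fun y hy => le_of_eq ?_
  rw [smul_smul, ← Complex.exp_add, enorm_smul, ← ofReal_norm, Complex.norm_exp,
    abs_of_nonneg (sub_nonneg.2 hy)]
  congr 3
  simp; ring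

lemma enorm_rightInt_le (μ : ℂ) (u : ℝ → C2) (x : ℝ) :
    ‖rightInt μ u x‖ₑ
      ≤ ∫⁻ y in Set.Ioi x, ENNReal.ofReal (Real.exp (μ.re * |x - y|)) * ‖u y‖ₑ := by
  rw [rightInt, ← integral_smul]
  refine (enorm_integral_le_lintegral_enorm _).trans ?_
  refine setLIntegral_mono' measurableSet_Ioi fun y hy => le_of_eq ?_
  rw [smul_smul, ← Complex.exp_add, enorm_smul, ← ofReal_norm, Complex.norm_exp,
    abs_of_nonpos (sub_nonpos.2 (le_of_lt hy))]
  congr 3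
  simp; ring

lemma lintegral_exp_abs_lt_top {κ : ℝ} (hκ : κ < 0) :
    ∫⁻ x : ℝ, ENNReal.ofReal (Real.exp (κ * |x|)) < ⊤ := by
  have h : Integrable fun x : ℝ => Real.exp (κ * |x|) := by
    rw [← integrableOn_univ, ← Set.Iic_union_Ioi (a := (0 : ℝ))]
    refine IntegrableOn.union ?_ ?_
    · refine (integrableOn_exp_mul_Iic (neg_pos.2 hκ) 0).congr_fun (fun x hx => ?_) measurableSet_Iic
      simp [abs_of_nonpos (Set.mem_Iic.1 hx)]
    · refine (integrableOn_exp_mul_Ioi hκ 0).congr_fun (fun x hx => ?_) measurableSet_Ioi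
      simp [abs_of_pos (Set.mem_Ioi.1 hx)]
  exact h.lintegral_lt_top

end ExpIntegrals

/-! ### The resolvent of the free Dirac operator -/

section FreeResolvent

variable {m : ℝ} {z k : ℂ}

/-- The function `x ↦ ∫ e^{ik|x-y|} kernelCoeff m z k (sgn (x - y)) g(y) dy`. -/
def resolventFun (m : ℝ) (z k : ℂ) (g : L2) (x : ℝ) : C2 :=
  leftInt (Complex.I * k) (fun y => kernelCoeff m z k 1 (g y)) x
    + rightInt (Complex.I * k) (fun y => kernelCoeff m z k (-1) (g y)) x

lemma re_I_mul_neg (hk : 0 < k.im) : (Complex.I * k).re < 0 := by simpa using hk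

lemma memLp_apply (T : C2 →L[ℂ] C2) (g : L2) : MemLp (fun y => T (g y)) 2 (volume : Measure ℝ) :=
  T.comp_memLp' (Lp.memLp g)

lemma continuous_resolventFun (hk : 0 < k.im) (g : L2) : Continuous (resolventFun m z k g) :=
  (continuous_leftInt (re_I_mul_neg hk) (memLp_apply _ g)).add
    (continuous_rightInt (re_I_mul_neg hk) (memLp_apply _ g))

/-- The bound for the resolvent kernel of the free Dirac operator. -/
def kernelBound (m : ℝ) (z k : ℂ) : ℝ := (‖z + m‖ + ‖z - m‖) / (2 * ‖k‖)

lemma kernelBound_nonneg : 0 ≤ kernelBound m z k := by unfold kernelBound; positivity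

/-- The function `t ↦ kernelBound m z k * e^{-(Im k) |t|}`, which dominates the norm of the
resolvent kernel at `t = x - y`. -/
def kernelMajorant (m : ℝ) (z k : ℂ) (t : ℝ) : ENNReal :=
  ENNReal.ofReal (kernelBound m z k) * ENNReal.ofReal (Real.exp ((Complex.I * k).re * |t|))

lemma measurable_kernelMajorant : Measurable (kernelMajorant m z k) := by
  unfold kernelMajorant
  fun_prop

lemma kernelMajorant_le (hk : 0 < k.im) (t : ℝ) :
    kernelMajorant m z k t ≤ ENNReal.ofReal (kernelBound m z k) := by
  refine mul_le_of_le_one_right' ?_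
  rw [ENNReal.ofReal_le_one, Real.exp_le_one_iff]
  exact mul_nonpos_of_nonpos_of_nonneg (re_I_mul_neg hk).le (abs_nonneg _)

lemma lintegral_kernelMajorant_ne_top (hk : 0 < k.im) :
    ∫⁻ t, kernelMajorant m z k t ≠ ⊤ := by
  unfold kernelMajorant
  rw [lintegral_const_mul' _ _ ENNReal.ofReal_ne_top]
  exact ENNReal.mul_ne_top ENNReal.ofReal_ne_top (lintegral_exp_abs_lt_top (re_I_mul_neg hk)).ne

lemma lintegral_kernelMajorant_sq_ne_top (hk : 0 < k.im) :
    ∫⁻ t, kernelMajorant m z k t ^ 2 ≠ ⊤ := by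
  have h : ∫⁻ t, kernelMajorant m z k t ^ 2
      ≤ ∫⁻ t, ENNReal.ofReal (kernelBound m z k) * kernelMajorant m z k t := by
    refine lintegral_mono fun t => ?_
    rw [sq]
    exact mul_le_mul_left (kernelMajorant_le hk t) _
  refine ne_top_of_le_ne_top ?_ h
  rw [lintegral_const_mul' _ _ ENNReal.ofReal_ne_top]
  exact ENNReal.mul_ne_top ENNReal.ofReal_ne_top (lintegral_kernelMajorant_ne_top hk)

lemma enorm_resolventFun_le (hkz : k ^ 2 = z ^ 2 - m ^ 2) (hk : 0 < k.im) (g : L2) (x : ℝ) :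
    ‖resolventFun m z k g x‖ₑ ≤ ∫⁻ y, kernelMajorant m z k (x - y) * ‖g y‖ₑ := by
  have hk0 : k ≠ 0 := by rintro rfl; simp at hk
  have hM : ∀ s : ℂ, ‖s‖ = 1 → ∀ y, ENNReal.ofReal (Real.exp ((Complex.I * k).re * |x - y|))
      * ‖kernelCoeff m z k s (g y)‖ₑ ≤ kernelMajorant m z k (x - y) * ‖g y‖ₑ := by
    intro s hs y
    rw [kernelMajorant, mul_comm (ENNReal.ofReal (kernelBound m z k)), mul_assoc]
    refine mul_le_mul_right ?_ _
    rw [← ofReal_norm, ← ofReal_norm, ← ENNReal.ofReal_mul kernelBound_nonneg]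
    exact ENNReal.ofReal_le_ofReal (((kernelCoeff m z k s).le_opNorm _).trans
      (mul_le_mul_of_nonneg_right (norm_kernelCoeff_le hkz hk0 s hs) (norm_nonneg _)))
  calc ‖resolventFun m z k g x‖ₑ
      ≤ _ := enorm_add_le _ _
    _ ≤ (∫⁻ y in Set.Iic x, kernelMajorant m z k (x - y) * ‖g y‖ₑ)
        + ∫⁻ y in Set.Ioi x, kernelMajorant m z k (x - y) * ‖g y‖ₑ :=
      add_le_add
        ((enorm_leftInt_le _ _ _).trans (lintegral_mono fun y => hM 1 (by simp) y))
        ((enorm_rightInt_le _ _ _).trans (lintegral_mono fun y => hM (-1) (by simp) y))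
    _ = ∫⁻ y, kernelMajorant m z k (x - y) * ‖g y‖ₑ := by
      rw [← Set.compl_Iic, lintegral_add_compl _ measurableSet_Iic]

lemma lintegral_enorm_sq (g : L2) : ∫⁻ x, ‖g x‖ₑ ^ 2 = ‖g‖ₑ ^ 2 := by
  rw [Lp.enorm_def, eLpNorm_eq_lintegral_rpow_enorm_toReal (by norm_num) (by norm_num),
    ← ENNReal.rpow_mul_natCast]
  simp

lemma aemeasurable_enorm (g : L2) : AEMeasurable fun x => ‖g x‖ₑ :=
  (Lp.aestronglyMeasurable g).enorm

lemma eLpNorm_two_sq (f : ℝ → C2) : eLpNorm f 2 volume ^ 2 = ∫⁻ x, ‖f x‖ₑ ^ 2 := by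
  rw [eLpNorm_eq_lintegral_rpow_enorm_toReal (by norm_num) (by norm_num),
    ← ENNReal.rpow_mul_natCast]
  simp

lemma lintegral_resolventFun_sq_le (hkz : k ^ 2 = z ^ 2 - m ^ 2) (hk : 0 < k.im) (g : L2) :
    ∫⁻ x, ‖resolventFun m z k g x‖ₑ ^ 2 ≤ (∫⁻ t, kernelMajorant m z k t) ^ 2 * ‖g‖ₑ ^ 2 := by
  rw [← lintegral_enorm_sq]
  exact (lintegral_mono fun x => pow_le_pow_left' (enorm_resolventFun_le hkz hk g x) 2).trans
    (lintegral_convolution_sq_le_one_two measurable_kernelMajorant (aemeasurable_enorm g))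

lemma eLpNorm_resolventFun_le (hkz : k ^ 2 = z ^ 2 - m ^ 2) (hk : 0 < k.im) (g : L2) :
    eLpNorm (resolventFun m z k g) 2 volume ≤ (∫⁻ t, kernelMajorant m z k t) * ‖g‖ₑ := by
  rw [← ENNReal.pow_le_pow_left_iff (n := 2) (by norm_num), eLpNorm_two_sq, mul_pow]
  exact lintegral_resolventFun_sq_le hkz hk g

lemma memLp_resolventFun (hkz : k ^ 2 = z ^ 2 - m ^ 2) (hk : 0 < k.im) (g : L2) :
    MemLp (resolventFun m z k g) 2 (volume : Measure ℝ) :=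
  ⟨(continuous_resolventFun hk g).aestronglyMeasurable,
    (eLpNorm_resolventFun_le hkz hk g).trans_lt
      (ENNReal.mul_ne_top (lintegral_kernelMajorant_ne_top hk) enorm_ne_top).lt_top⟩

lemma resolventFun_add (hk : 0 < k.im) (f g : L2) (x : ℝ) :
    resolventFun m z k (f + g) x = resolventFun m z k f x + resolventFun m z k g x := by
  have h : ∀ T : C2 →L[ℂ] C2, (fun y => T ((f + g : L2) y)) =ᵐ[volume]
      fun y => T (f y) + T (g y) := fun T => by
    filter_upwards [Lp.coeFn_add f g] with y hy
    rw [hy, Pi.add_apply, map_add]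
  have hl := integral_congr_ae (μ := volume.restrict (Set.Iic x))
    ((ae_restrict_of_ae (h (kernelCoeff m z k 1))).mono fun y hy =>
      congrArg (fun v => Complex.exp (-(Complex.I * k) * y) • v) hy)
  have hr := integral_congr_ae (μ := volume.restrict (Set.Ioi x))
    ((ae_restrict_of_ae (h (kernelCoeff m z k (-1)))).mono fun y hy =>
      congrArg (fun v => Complex.exp (Complex.I * k * y) • v) hy)
  simp only [resolventFun, leftInt, rightInt]
  rw [hl, hr]
  simp only [smul_add]
  rw [integral_add (integrableOn_Iic_exp_smul (re_I_mul_neg hk) (memLp_apply _ f) x)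
      (integrableOn_Iic_exp_smul (re_I_mul_neg hk) (memLp_apply _ g) x),
    integral_add (integrableOn_Ioi_exp_smul (re_I_mul_neg hk) (memLp_apply _ f) x)
      (integrableOn_Ioi_exp_smul (re_I_mul_neg hk) (memLp_apply _ g) x)]
  simp only [smul_add]
  abel

lemma resolventFun_smul (c : ℂ) (f : L2) (x : ℝ) :
    resolventFun m z k (c • f) x = c • resolventFun m z k f x := by
  have h : ∀ T : C2 →L[ℂ] C2, (fun y => T ((c • f : L2) y)) =ᵐ[volume]
      fun y => c • T (f y) := fun T => by
    filter_upwards [Lp.coeFn_smul c f] with y hy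
    rw [hy, Pi.smul_apply, map_smul]
  have hl := integral_congr_ae (μ := volume.restrict (Set.Iic x))
    ((ae_restrict_of_ae (h (kernelCoeff m z k 1))).mono fun y hy =>
      congrArg (fun v => Complex.exp (-(Complex.I * k) * y) • v) hy)
  have hr := integral_congr_ae (μ := volume.restrict (Set.Ioi x))
    ((ae_restrict_of_ae (h (kernelCoeff m z k (-1)))).mono fun y hy =>
      congrArg (fun v => Complex.exp (Complex.I * k * y) • v) hy)
  simp only [resolventFun, leftInt, rightInt]
  rw [hl, hr]
  simp only [smul_comm _ c]
  rw [integral_smul, integral_smul, smul_comm _ c, smul_comm _ c, smul_add]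

/-- The resolvent `(H₀ - z)⁻¹` of the free Dirac operator, where `k² = z² - m²` and `Im k > 0`,
as an integral operator. -/
def freeResolvent (m : ℝ) (z k : ℂ) (hkz : k ^ 2 = z ^ 2 - m ^ 2) (hk : 0 < k.im) :
    L2 →L[ℂ] L2 :=
  LinearMap.mkContinuous
    { toFun := fun g => (memLp_resolventFun hkz hk g).toLp
      map_add' := fun f g => by
        rw [← MemLp.toLp_add]
        exact MemLp.toLp_congr _ _ (Filter.Eventually.of_forall (resolventFun_add hk f g))
      map_smul' := fun c f => by
        rw [RingHom.id_apply, ← MemLp.toLp_const_smul]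
        exact MemLp.toLp_congr _ _ (Filter.Eventually.of_forall (resolventFun_smul c f)) }
    (∫⁻ t, kernelMajorant m z k t).toReal (fun g => by
      have h := ENNReal.toReal_mono (ENNReal.mul_ne_top (lintegral_kernelMajorant_ne_top hk)
        enorm_ne_top) (eLpNorm_resolventFun_le hkz hk g)
      rw [ENNReal.toReal_mul, toReal_enorm] at h
      exact (Lp.norm_toLp _ (memLp_resolventFun hkz hk g)).trans_le h)

variable (hkz : k ^ 2 = z ^ 2 - m ^ 2) (hk : 0 < k.im)

lemma freeResolvent_coeFn (g : L2) :
    freeResolvent m z k hkz hk g =ᵐ[volume] resolventFun m z k g :=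
  (memLp_resolventFun hkz hk g).coeFn_toLp

lemma enorm_freeResolvent_le (g : L2) : ∀ᵐ x, ‖freeResolvent m z k hkz hk g x‖ₑ
    ≤ ∫⁻ y, kernelMajorant m z k (x - y) * ‖g y‖ₑ := by
  filter_upwards [freeResolvent_coeFn hkz hk g] with x hx
  rw [hx]
  exact enorm_resolventFun_le hkz hk g x

lemma coeffN_leftInt {T : C2 →L[ℂ] C2} {μ ν : ℂ} (hμ : μ.re < 0)
    (hT : ∀ v, coeffN m z (T v) = ν • T v) (g : L2) (x : ℝ) :
    coeffN m z (leftInt μ (fun y => T (g y)) x) = ν • leftInt μ (fun y => T (g y)) x := by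
  rw [leftInt, map_smul, smul_comm ν]
  congr 1
  rw [← ContinuousLinearMap.integral_comp_comm _ (integrableOn_Iic_exp_smul hμ (memLp_apply T g) x),
    ← integral_smul]
  simp only [map_smul, hT, smul_comm ν]

lemma coeffN_rightInt {T : C2 →L[ℂ] C2} {μ ν : ℂ} (hμ : μ.re < 0)
    (hT : ∀ v, coeffN m z (T v) = ν • T v) (g : L2) (x : ℝ) :
    coeffN m z (rightInt μ (fun y => T (g y)) x) = ν • rightInt μ (fun y => T (g y)) x := by
  rw [rightInt, map_smul, smul_comm ν]
  congr 1
  rw [← ContinuousLinearMap.integral_comp_comm _ (integrableOn_Ioi_exp_smul hμ (memLp_apply T g) x),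
    ← integral_smul]
  simp only [map_smul, hT, smul_comm ν]

lemma coeffN_resolventFun (hkz : k ^ 2 = z ^ 2 - m ^ 2) (hk : 0 < k.im) (g : L2) (t : ℝ) :
    coeffN m z (resolventFun m z k g t) + Complex.I • sigma1 (g t)
      = ((Complex.I * k) • leftInt (Complex.I * k)
        (fun y => kernelCoeff m z k 1 (g y)) t + kernelCoeff m z k 1 (g t))
      + (-(Complex.I * k) • rightInt (Complex.I * k)
        (fun y => kernelCoeff m z k (-1) (g y)) t - kernelCoeff m z k (-1) (g t)) := by
  have hk0 : k ≠ 0 := by rintro rfl; simp at hk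
  have hμ := re_I_mul_neg hk
  rw [resolventFun, map_add,
    coeffN_leftInt hμ (coeffN_kernelCoeff hkz hk0 1 (one_mul 1)) g t,
    coeffN_rightInt hμ (coeffN_kernelCoeff hkz hk0 (-1) (by norm_num)) g t,
    ← kernelCoeff_sub (m := m) (z := z) (k := k), one_mul, neg_one_mul]
  abel

lemma intervalIntegrable_leftInt {μ ν : ℂ} (hμ : μ.re < 0) {u : ℝ → C2} (hu : MemLp u 2 volume)
    (x : ℝ) : IntervalIntegrable (fun t => ν • leftInt μ u t + u t) volume 0 x :=
  (((continuous_leftInt hμ hu).const_smul ν).intervalIntegrable 0 x).add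
    (intervalIntegrable_of_locallyIntegrable (hu.locallyIntegrable (by norm_num)) 0 x)

lemma intervalIntegrable_rightInt {μ ν : ℂ} (hμ : μ.re < 0) {u : ℝ → C2} (hu : MemLp u 2 volume)
    (x : ℝ) : IntervalIntegrable (fun t => ν • rightInt μ u t - u t) volume 0 x :=
  (((continuous_rightInt hμ hu).const_smul ν).intervalIntegrable 0 x).sub
    (intervalIntegrable_of_locallyIntegrable (hu.locallyIntegrable (by norm_num)) 0 x)

/-- The differential equation `f' = N f + i σ₁ g` for `f = R₀(z) g`, in integrated form. -/
lemma resolventFun_integral (hkz : k ^ 2 = z ^ 2 - m ^ 2) (hk : 0 < k.im) (g : L2) (x : ℝ) :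
    resolventFun m z k g x = resolventFun m z k g 0
      + ∫ t in (0 : ℝ)..x, (coeffN m z (resolventFun m z k g t) + Complex.I • sigma1 (g t)) := by
  have hμ := re_I_mul_neg hk
  have hp := memLp_apply (kernelCoeff m z k 1) g
  have hm := memLp_apply (kernelCoeff m z k (-1)) g
  simp only [coeffN_resolventFun hkz hk g]
  rw [intervalIntegral.integral_add (intervalIntegrable_leftInt hμ hp x)
    (intervalIntegrable_rightInt hμ hm x)]
  conv_lhs => rw [resolventFun, leftInt_integral hμ hp, rightInt_integral hμ hm]
  rw [resolventFun, add_add_add_comm]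

lemma hasL2Deriv_freeResolvent (g : L2) : HasL2Deriv (freeResolvent m z k hkz hk g)
    ((coeffN m z).compLpL 2 volume (freeResolvent m z k hkz hk g)
      + Complex.I • sigma1.compLpL 2 volume g) := by
  refine ⟨resolventFun m z k g 0, ?_⟩
  filter_upwards [freeResolvent_coeFn hkz hk g] with x hx
  rw [hx, resolventFun_integral hkz hk g x]
  congr 1
  refine intervalIntegral.integral_congr_ae ?_
  filter_upwards [Lp.coeFn_add ((coeffN m z).compLpL 2 volume (freeResolvent m z k hkz hk g))
      (Complex.I • sigma1.compLpL 2 volume g), Lp.coeFn_smul Complex.I (sigma1.compLpL 2 volume g),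
      (coeffN m z).coeFn_compLpL (p := 2) (μ := volume) (freeResolvent m z k hkz hk g),
      sigma1.coeFn_compLpL (p := 2) (μ := volume) g, freeResolvent_coeFn hkz hk g]
      with t h1 h2 h3 h4 h5 _
  rw [h1, Pi.add_apply, h2, Pi.smul_apply, h3, h4, h5]

lemma isResolvent_right (g : L2) :
    ∃ h : freeResolvent m z k hkz hk g ∈ (freeDirac m).domain,
      freeDirac m ⟨freeResolvent m z k hkz hk g, h⟩ - z • freeResolvent m z k hkz hk g = g := by
  have hd := hasL2Deriv_freeResolvent hkz hk g
  set f := freeResolvent m z k hkz hk g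
  refine ⟨mem_freeDirac_domain m hd, ?_⟩
  rw [sub_eq_iff_eq_add]
  refine Lp.ext ?_
  filter_upwards [freeDirac_coeFn m hd (mem_freeDirac_domain m hd), Lp.coeFn_add g (z • f),
    Lp.coeFn_smul z f, Lp.coeFn_add ((coeffN m z).compLpL 2 volume f)
      (Complex.I • sigma1.compLpL 2 volume g), Lp.coeFn_smul Complex.I (sigma1.compLpL 2 volume g),
      (coeffN m z).coeFn_compLpL (p := 2) (μ := volume) f,
      sigma1.coeFn_compLpL (p := 2) (μ := volume) g] with x h1 h2 h3 h4 h5 h6 h7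
  rw [h1, h2, h4, Pi.add_apply, Pi.add_apply, h3, h5, Pi.smul_apply, Pi.smul_apply, h6, h7,
    dirac_coeffN, add_comm]

/-- A pure exponential does not belong to `L²(ℝ)`. -/
lemma eq_zero_of_memLp_exp (ν : ℂ) (p : C2)
    (h : MemLp (fun x : ℝ => Complex.exp (ν * x) • p) 2 (volume : Measure ℝ)) : p = 0 := by
  obtain ⟨s, hs, hsm, hsν⟩ : ∃ s : Set ℝ, volume s = ⊤ ∧ MeasurableSet s ∧
      ∀ x ∈ s, 0 ≤ ν.re * x := by
    rcases le_total 0 ν.re with h0 | h0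
    · exact ⟨Set.Ici 0, by simp, measurableSet_Ici, fun x hx => mul_nonneg h0 hx⟩
    · exact ⟨Set.Iic 0, by simp, measurableSet_Iic, fun x hx => mul_nonneg_of_nonpos_of_nonpos h0 hx⟩
  have h1 : MemLp (fun _ : ℝ => p) 2 (volume.restrict s) := by
    refine (h.restrict s).of_le aestronglyMeasurable_const ?_
    refine (ae_restrict_iff' hsm).2 (Filter.Eventually.of_forall fun x hx => ?_)
    rw [norm_smul, Complex.norm_exp]
    refine le_mul_of_one_le_left (norm_nonneg _) (Real.one_le_exp ?_)
    simpa using hsν x hx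
  rw [memLp_const_iff (by norm_num) (by norm_num)] at h1
  simpa [hs] using h1

/-- An eigenfunction `f` solves `f' = N f`; the components `(N ± ik) f` are pure exponentials. -/
lemma eq_zero_of_freeDirac_eq (f : (freeDirac m).domain) (hf : freeDirac m f = z • (f : L2))
    (hkz : k ^ 2 = z ^ 2 - m ^ 2) (hk : 0 < k.im) : (f : L2) = 0 := by
  have hk0 : k ≠ 0 := by rintro rfl; simp at hk
  obtain ⟨g, hg⟩ := exists_hasL2Deriv f
  have hgN : g =ᵐ[volume] fun x => coeffN m z ((f : L2) x) := by
    filter_upwards [freeDirac_coeFn m hg f.2, Lp.coeFn_smul z (f : L2)] with x h1 h2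
    refine eq_coeffN_of_dirac ?_
    rw [← h1, Subtype.coe_eta, hf, h2, Pi.smul_apply]
  obtain ⟨c, hc⟩ := hg
  set F : ℝ → C2 := fun x => c + ∫ t in (0 : ℝ)..x, g t with hF
  have hFc : Continuous F := continuous_const.add
    (intervalIntegral.continuous_primitive (fun a b => intervalIntegrable_L2 g a b) 0)
  have hFd : ∀ x, HasDerivAt F (coeffN m z (F x)) x := by
    have h1 : F = fun x => c + ∫ t in (0 : ℝ)..x, coeffN m z (F t) := by
      ext1 x
      simp only [hF]
      congr 1
      refine intervalIntegral.integral_congr_ae ?_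
      filter_upwards [hgN, hc] with t h1 h2 _
      rw [h1, h2]
    intro x
    have h2 := (((coeffN m z).continuous.comp hFc).integral_hasStrictDerivAt 0 x).hasDerivAt
    have h3 := h2.const_add c
    conv in HasDerivAt F => rw [h1]
    exact h3
  have key : ∀ μ : ℂ, μ ^ 2 = (Complex.I * k) ^ 2 → ∀ x, coeffN m z (F x) + μ • F x = 0 := by
    intro μ hμ
    have hd : ∀ x : ℝ, HasDerivAt
        (fun x : ℝ => Complex.exp (-μ * x) • (coeffN m z (F x) + μ • F x)) 0 x := by
      intro x
      have h3 : HasDerivAt (fun s : ℝ => Complex.exp (-μ * s)) (Complex.exp (-μ * x) * -μ) x := by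
        have h4 : HasDerivAt (fun s : ℝ => -μ * (s : ℂ)) (-μ * 1) x :=
          (Complex.ofRealCLM.hasDerivAt (x := x)).const_mul (-μ)
        simpa using h4.cexp
      have h5 : HasDerivAt (fun s : ℝ => coeffN m z (F s))
          (coeffN m z (coeffN m z (F x))) x :=
        ((coeffN m z).restrictScalars ℝ).hasFDerivAt.comp_hasDerivAt x (hFd x)
      convert! h3.smul (h5.add ((hFd x).const_smul μ)) using 1
      rw [coeffN_coeffN hkz, ← hμ, sq]
      simp only [Pi.add_apply, Pi.smul_apply]
      module
    have hconst : ∀ x : ℝ, coeffN m z (F x) + μ • F x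
        = Complex.exp (μ * x) • (coeffN m z (F 0) + μ • F 0) := by
      intro x
      have h6 := is_const_of_deriv_eq_zero (fun x => (hd x).differentiableAt)
        (fun x => (hd x).deriv) x 0
      simp only [Complex.ofReal_zero, mul_zero, Complex.exp_zero, one_smul] at h6
      rw [← h6, smul_smul, ← Complex.exp_add]
      simp
    have h7 : coeffN m z (F 0) + μ • F 0 = 0 := by
      refine eq_zero_of_memLp_exp μ _ ?_
      simp only [← hconst]
      have h8 : MemLp F 2 (volume : Measure ℝ) := (memLp_congr_ae hc).1 (Lp.memLp (f : L2))
      exact ((coeffN m z).comp_memLp' h8).add (h8.const_smul μ)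
    intro x
    rw [hconst, h7, smul_zero]
  have hF0 : ∀ x, F x = 0 := by
    intro x
    have h1 := key (Complex.I * k) rfl x
    have h2 := key (-(Complex.I * k)) (neg_sq _) x
    have h3 : (2 * (Complex.I * k)) • F x = 0 := by
      calc (2 * (Complex.I * k)) • F x = (coeffN m z (F x) + (Complex.I * k) • F x)
          - (coeffN m z (F x) + (-(Complex.I * k)) • F x) := by module
        _ = 0 := by rw [h1, h2, sub_zero]
    exact (smul_eq_zero.1 h3).resolve_left (by simp [hk0])
  refine Lp.ext ?_
  filter_upwards [hc, Lp.coeFn_zero C2 2 (volume : Measure ℝ)] with x h1 h2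
  rw [h2, h1]
  exact hF0 x

lemma isResolvent_freeResolvent :
    IsResolvent (freeDirac m) z (freeResolvent m z k hkz hk) := by
  refine ⟨isResolvent_right hkz hk, fun f => ?_⟩
  obtain ⟨h1, h2⟩ := isResolvent_right hkz hk (freeDirac m f - z • (f : L2))
  set f' : (freeDirac m).domain := ⟨_, h1⟩ with hf'
  have h3 : freeDirac m (f' - f) = z • ((f' - f : (freeDirac m).domain) : L2) := by
    rw [LinearPMap.map_sub, Submodule.coe_sub, smul_sub, sub_eq_sub_iff_sub_eq_sub]
    exact h2
  have h4 := eq_zero_of_freeDirac_eq (f' - f) h3 hkz hk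
  rw [Submodule.coe_sub, sub_eq_zero] at h4
  exact h4

end FreeResolvent

section DenseDomain

/-- Compactly supported smooth functions belong to `H¹`. -/
lemma dense_freeDirac_domain (m : ℝ) : Dense ((freeDirac m).domain : Set L2) := by
  refine (Lp.dense_hasCompactSupport_contDiff (p := 2) (by norm_num)).mono ?_
  rintro f ⟨φ, hfφ, hφs, hφ⟩
  have hφ' : Continuous (deriv φ) := hφ.continuous_deriv (by simp)
  have hg : MemLp (deriv φ) 2 (volume : Measure ℝ) :=
    hφ'.memLp_of_hasCompactSupport hφs.deriv
  refine mem_freeDirac_domain m (g := hg.toLp) ⟨φ 0, ?_⟩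
  filter_upwards [hfφ] with x hx
  rw [hx, intervalIntegral.integral_congr_ae (hg.coeFn_toLp.mono fun t ht _ => ht),
    intervalIntegral.integral_deriv_eq_sub
      (fun t _ => (hφ.differentiable (by simp)).differentiableAt) (hφ'.intervalIntegrable _ _)]
  abel

end DenseDomain

/-! ### Approximate eigenvectors -/

section SingularSequence

variable {E F : Type*} [NormedAddCommGroup E] [InnerProductSpace ℂ E]
  [NormedAddCommGroup F] [InnerProductSpace ℂ F]
  {H₀ : E →ₗ.[ℂ] E} {A : E →ₗ.[ℂ] F} {B : F →ₗ.[ℂ] E} {z w : ℂ}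

/-- If `H₀` has approximate eigenvectors at `w` on which `A` is small, then `w` belongs to the
spectrum of the perturbed operator. -/
lemma BSData.mem_spec_of_approximate (D : BSData H₀ A B z) {H : E →ₗ.[ℂ] E}
    (hH : IsResolvent H z D.formula)
    (h : ∀ δ > 0, ∃ (f : H₀.domain) (hA : (f : E) ∈ A.domain), (f : E) ≠ 0 ∧
      ‖H₀ f - w • (f : E)‖ ≤ δ * ‖(f : E)‖ ∧ ‖A ⟨f, hA⟩‖ ≤ δ * ‖(f : E)‖) :
    w ∈ spec H := by
  rintro ⟨R, hR⟩
  set T : F →L[ℂ] E := D.R₀B ∘L Ring.inverse (1 + D.Q) with hT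
  set C : ℝ := ‖R‖ * (‖w - z‖ * ‖T‖ + 1) + ‖T‖ with hC
  have hC0 : 0 ≤ C := by positivity
  obtain ⟨f, hA, hf0, hf1, hf2⟩ := h (1 / (2 * (C + 1))) (by positivity)
  set δ : ℝ := 1 / (2 * (C + 1)) with hδ
  -- `u = (H - z)⁻¹ (H₀ - z) f` is close to `f`, and `(H - w) u` is small.
  set u := D.formula (H₀ f - z • (f : E)) with hu
  have h1 : D.R₀ (H₀ f - z • (f : E)) = f := D.isResolvent.2 f
  have h2 : D.AR₀ (H₀ f - z • (f : E)) = A ⟨f, hA⟩ := by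
    rw [← D.apply_eq_AR₀ _ (D.R₀_mem _)]
    congr 1
    exact Subtype.ext h1
  have h3 : u = f - T (A ⟨f, hA⟩) := by rw [hu, D.formula_apply, h1, h2]; rfl
  have h4 : u = R ((w - z) • T (A ⟨f, hA⟩) + (H₀ f - w • (f : E))) := by
    have h5 := hH.apply_sub_apply hR (H₀ f - z • (f : E))
    rw [← hu, ← map_smul, sub_eq_iff_eq_add, ← sub_eq_iff_eq_add', ← map_sub] at h5
    rw [← h5, h3]
    congr 1
    module
  have h6 : ‖T (A ⟨f, hA⟩)‖ ≤ ‖T‖ * (δ * ‖(f : E)‖) :=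
    (T.le_opNorm _).trans (mul_le_mul_of_nonneg_left hf2 (norm_nonneg _))
  have h7 : ‖u‖ ≤ ‖R‖ * (‖w - z‖ * (‖T‖ * (δ * ‖(f : E)‖)) + δ * ‖(f : E)‖) := by
    rw [h4]
    refine (R.le_opNorm _).trans (mul_le_mul_of_nonneg_left ?_ (norm_nonneg _))
    refine (norm_add_le _ _).trans (add_le_add ?_ hf1)
    rw [norm_smul]
    exact mul_le_mul_of_nonneg_left h6 (norm_nonneg _)
  have h8 : ‖(f : E)‖ ≤ ‖u‖ + ‖T (A ⟨f, hA⟩)‖ := by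
    have : (f : E) = u + T (A ⟨f, hA⟩) := by rw [h3]; abel
    calc ‖(f : E)‖ = ‖u + T (A ⟨f, hA⟩)‖ := by rw [← this]
      _ ≤ _ := norm_add_le _ _
  have h9 : ‖(f : E)‖ ≤ C * δ * ‖(f : E)‖ := by
    refine h8.trans ((add_le_add h7 h6).trans (le_of_eq ?_))
    rw [hC]; ring
  have h10 : C * δ < 1 := by
    rw [hδ, mul_one_div, div_lt_one (by positivity)]
    linarith
  have h11 : 0 < ‖(f : E)‖ := norm_pos_iff.2 hf0
  nlinarith

end SingularSequence

/-! ### Bounds for the factors of the potential -/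

section Factors

variable {V : ℝ → Matrix (Fin 2) (Fin 2) ℂ}

lemma norm_le_of_enorm_sq_le {f g : L2} {K : ENNReal} (hK : K ≠ ⊤)
    (h : ‖f‖ₑ ^ 2 ≤ K * ‖g‖ₑ ^ 2) : ‖f‖ ≤ √K.toReal * ‖g‖ := by
  have h1 := ENNReal.toReal_mono (ENNReal.mul_ne_top hK (ENNReal.pow_ne_top enorm_ne_top)) h
  rw [ENNReal.toReal_mul, ENNReal.toReal_pow, ENNReal.toReal_pow, toReal_enorm, toReal_enorm] at h1
  refine abs_le_of_sq_le_sq' ?_ (by positivity) |>.2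
  rwa [mul_pow, Real.sq_sqrt ENNReal.toReal_nonneg]

/-- Multiplication by `|V|^{1/2}` is bounded from `L^∞` to `L²`. -/
lemma lintegral_factorA_sq_le (hV : ∀ i j : Fin 2, Integrable (fun x : ℝ => V x i j)) {f : L2}
    {S : ENNReal} (hS : ∀ᵐ x, ‖f x‖ₑ ≤ S) :
    ∫⁻ x, ‖factorA V x (f x)‖ₑ ^ 2 ≤ ENNReal.ofReal (potNorm V) * S ^ 2 := by
  rw [← lintegral_enorm_factorA_sq hV,
    ← lintegral_mul_const'' _ ((aestronglyMeasurable_factorA hV).enorm.pow_const 2)]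
  refine lintegral_mono_ae ?_
  filter_upwards [hS] with x hx
  rw [← mul_pow]
  exact pow_le_pow_left' (((factorA V x).le_opENorm _).trans (mul_le_mul_right hx _)) 2

lemma mem_factorA_domain (hV : ∀ i j : Fin 2, Integrable (fun x : ℝ => V x i j)) {f : L2}
    {S : ENNReal} (hS : ∀ᵐ x, ‖f x‖ₑ ≤ S) (hS' : S ≠ ⊤) : f ∈ (mulOp (factorA V)).domain := by
  refine ⟨aestronglyMeasurable_apply (aestronglyMeasurable_factorA hV) f, ?_⟩
  have h : eLpNorm (fun x => factorA V x (f x)) 2 volume ^ 2 ≠ ⊤ := by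
    rw [eLpNorm_two_sq]
    exact ne_top_of_le_ne_top (ENNReal.mul_ne_top ENNReal.ofReal_ne_top (ENNReal.pow_ne_top hS'))
      (lintegral_factorA_sq_le hV hS)
  exact lt_top_iff_ne_top.2 fun h' => h (by rw [h']; simp)

lemma enorm_factorA_sq_le (hV : ∀ i j : Fin 2, Integrable (fun x : ℝ => V x i j)) {f : L2}
    (hf : f ∈ (mulOp (factorA V)).domain) {S : ENNReal} (hS : ∀ᵐ x, ‖f x‖ₑ ≤ S) :
    ‖mulOp (factorA V) ⟨f, hf⟩‖ₑ ^ 2 ≤ ENNReal.ofReal (potNorm V) * S ^ 2 := by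
  rw [← lintegral_enorm_sq]
  refine le_trans (le_of_eq ?_) (lintegral_factorA_sq_le hV hS)
  refine lintegral_congr_ae ?_
  filter_upwards [mulOp_coeFn (M := factorA V) ⟨f, hf⟩] with x hx
  rw [hx]

/-- Multiplication by `U |V|^{1/2}` is bounded from `L²` to `L¹`. -/
lemma lintegral_factorB_sq_le (hV : ∀ i j : Fin 2, Integrable (fun x : ℝ => V x i j))
    (f : (mulOp (factorB V)).domain) :
    (∫⁻ x, ‖mulOp (factorB V) f x‖ₑ) ^ 2 ≤ ENNReal.ofReal (potNorm V) * ‖(f : L2)‖ₑ ^ 2 := by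
  rw [← lintegral_enorm_factorB_sq hV, ← lintegral_enorm_sq]
  refine le_trans (pow_le_pow_left' (lintegral_mono_ae ?_) 2) (lintegral_mul_sq_le
    (aestronglyMeasurable_factorB hV).enorm (aemeasurable_enorm (f : L2)))
  filter_upwards [mulOp_coeFn (M := factorB V) f] with x hx
  rw [hx]
  exact (factorB V x).le_opENorm _

/-- `V f = B A f` for `f` in the domains of `A` and `V`. -/
lemma mulOp_factorB_factorA (V : ℝ → Matrix (Fin 2) (Fin 2) ℂ) {f : L2}
    (hA : f ∈ (mulOp (factorA V)).domain) (hVf : f ∈ (mulOp (potOp V)).domain) :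
    ∃ h : mulOp (factorA V) ⟨f, hA⟩ ∈ (mulOp (factorB V)).domain,
      mulOp (factorB V) ⟨_, h⟩ = mulOp (potOp V) ⟨f, hVf⟩ := by
  have h1 : (fun x => factorB V x (mulOp (factorA V) ⟨f, hA⟩ x)) =ᵐ[volume]
      fun x => potOp V x (f x) := by
    filter_upwards [mulOp_coeFn (M := factorA V) ⟨f, hA⟩] with x hx
    rw [hx, ← factorB_mul_factorA]
    rfl
  have h : mulOp (factorA V) ⟨f, hA⟩ ∈ (mulOp (factorB V)).domain := (memLp_congr_ae h1).2 hVf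
  refine ⟨h, Lp.ext ?_⟩
  exact (mulOp_coeFn (M := factorB V) ⟨_, h⟩).trans
    (h1.trans (mulOp_coeFn (M := potOp V) ⟨f, hVf⟩).symm)

end Factors

/-! ### The Birman–Schwinger operators -/

section BirmanSchwingerData

variable {V : ℝ → Matrix (Fin 2) (Fin 2) ℂ} {m : ℝ} {z k : ℂ}

/-- The Birman–Schwinger operators exist off the spectrum of `H₀`, and `Q(z)` is bounded by
`‖V‖₁` times the supremum of the resolvent kernel. -/
lemma exists_BSData (hV : ∀ i j : Fin 2, Integrable (fun x : ℝ => V x i j))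
    (hkz : k ^ 2 = z ^ 2 - m ^ 2) (hk : 0 < k.im) :
    ∃ D : BSData (freeDirac m) (mulOp (factorA V)) (mulOp (factorB V)) z,
      ‖D.Q‖ ≤ kernelBound m z k * potNorm V := by
  set R := freeResolvent m z k hkz hk
  set Φ := ∫⁻ t, kernelMajorant m z k t ^ 2
  have hΦ : Φ ≠ ⊤ := lintegral_kernelMajorant_sq_ne_top hk
  have hv : 0 ≤ potNorm V := integral_nonneg fun _ => norm_nonneg _
  have hsup : ∀ g : L2, ∀ᵐ x, ‖R g x‖ₑ ≤ (Φ * ‖g‖ₑ ^ 2) ^ (2⁻¹ : ℝ) := by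
    intro g
    filter_upwards [enorm_freeResolvent_le hkz hk g] with x hx
    refine hx.trans ?_
    rw [ENNReal.le_rpow_inv_iff (by norm_num), ← lintegral_enorm_sq]
    exact_mod_cast convolution_sq_le_two_two measurable_kernelMajorant (aemeasurable_enorm g) x
  have hS : ∀ g : L2, (Φ * ‖g‖ₑ ^ 2) ^ (2⁻¹ : ℝ) ≠ ⊤ := fun g =>
    ENNReal.rpow_ne_top_of_nonneg (by norm_num)
      (ENNReal.mul_ne_top hΦ (ENNReal.pow_ne_top enorm_ne_top))
  have hmem : ∀ g, R g ∈ (mulOp (factorA V)).domain := fun g =>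
    mem_factorA_domain hV (hsup g) (hS g)
  let AR : L2 →L[ℂ] L2 := LinearMap.mkContinuous
    { toFun := fun g => mulOp (factorA V) ⟨R g, hmem g⟩
      map_add' := fun f g => by
        rw [← LinearPMap.map_add]
        congr 1
        exact Subtype.ext (map_add R f g)
      map_smul' := fun c f => by
        rw [RingHom.id_apply, ← LinearPMap.map_smul]
        congr 1
        exact Subtype.ext (map_smul R c f) }
    √(ENNReal.ofReal (potNorm V) * Φ).toReal (fun g => by
      refine norm_le_of_enorm_sq_le (ENNReal.mul_ne_top ENNReal.ofReal_ne_top hΦ) ?_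
      refine (enorm_factorA_sq_le hV (hmem g) (hsup g)).trans (le_of_eq ?_)
      rw [← ENNReal.rpow_mul_natCast, mul_assoc]
      simp)
  have hAR : ∀ g, AR g = mulOp (factorA V) ⟨R g, hmem g⟩ := fun g => rfl
  have hBd := dense_mulOp_domain (aestronglyMeasurable_factorB hV)
  obtain ⟨RB, hRB, -⟩ := exists_hasBoundedClosure
    ((R : L2 →ₗ[ℂ] L2).compPMap (mulOp (factorB V))) hBd
    √(Φ * ENNReal.ofReal (potNorm V)).toReal (fun f => by
      refine norm_le_of_enorm_sq_le (ENNReal.mul_ne_top hΦ ENNReal.ofReal_ne_top) ?_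
      rw [mul_assoc, ← lintegral_enorm_sq]
      calc ∫⁻ x, ‖R (mulOp (factorB V) f) x‖ₑ ^ 2
          ≤ ∫⁻ x, (∫⁻ y, kernelMajorant m z k (x - y) * ‖mulOp (factorB V) f y‖ₑ) ^ 2 := by
            refine lintegral_mono_ae ?_
            filter_upwards [enorm_freeResolvent_le hkz hk (mulOp (factorB V) f)] with x hx
            exact pow_le_pow_left' hx 2
        _ ≤ Φ * (∫⁻ y, ‖mulOp (factorB V) f y‖ₑ) ^ 2 :=
            lintegral_convolution_sq_le_two_one measurable_kernelMajorant (aemeasurable_enorm _)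
        _ ≤ _ := mul_le_mul_right (lintegral_factorB_sq_le hV f) _)
  obtain ⟨Q, hQ, hQn⟩ := exists_hasBoundedClosure
    ((AR : L2 →ₗ[ℂ] L2).compPMap (mulOp (factorB V))) hBd
    (kernelBound m z k * potNorm V) (fun f => by
      set c := kernelBound m z k
      have hc : 0 ≤ c := kernelBound_nonneg
      have h1 : ∀ᵐ x, ‖R (mulOp (factorB V) f) x‖ₑ
          ≤ ENNReal.ofReal c * ∫⁻ y, ‖mulOp (factorB V) f y‖ₑ := by
        filter_upwards [enorm_freeResolvent_le hkz hk (mulOp (factorB V) f)] with x hx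
        refine hx.trans ?_
        rw [← lintegral_const_mul' _ _ ENNReal.ofReal_ne_top]
        exact lintegral_mono fun y => mul_le_mul_left (kernelMajorant_le hk _) _
      have h2 : ‖AR (mulOp (factorB V) f)‖ₑ ^ 2
          ≤ ENNReal.ofReal ((c * potNorm V) ^ 2) * ‖(f : L2)‖ₑ ^ 2 := by
        rw [hAR]
        refine (enorm_factorA_sq_le hV (hmem _) h1).trans ?_
        rw [mul_pow]
        calc _ ≤ ENNReal.ofReal (potNorm V) * (ENNReal.ofReal c ^ 2 *
              (ENNReal.ofReal (potNorm V) * ‖(f : L2)‖ₑ ^ 2)) :=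
              mul_le_mul_right (mul_le_mul_right (lintegral_factorB_sq_le hV f) _) _
          _ = _ := by
            rw [ENNReal.ofReal_pow (by positivity), ENNReal.ofReal_mul hc]
            ring
      have h3 := norm_le_of_enorm_sq_le ENNReal.ofReal_ne_top h2
      rwa [ENNReal.toReal_ofReal (sq_nonneg _), Real.sqrt_sq (by positivity)] at h3)
  refine ⟨⟨R, isResolvent_freeResolvent hkz hk, AR, fun g => ⟨hmem g, hAR g⟩, RB, hRB, Q, hQ⟩, ?_⟩
  exact ContinuousLinearMap.opNorm_le_bound _ (mul_nonneg kernelBound_nonneg hv) hQn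

lemma isUnit_one_add {Q : L2 →L[ℂ] L2} (h : ‖Q‖ < 1) : IsUnit (1 + Q) := by
  have := isUnit_one_sub_of_norm_lt_one (x := -Q) (by rwa [norm_neg])
  rwa [sub_neg_eq_add] at this

end BirmanSchwingerData

/-! ### Approximate eigenfunctions of the free Dirac operator -/

section ApproximateEigenfunctions

/-- The cut-off plane wave `x ↦ (1 + ε² x²)⁻¹ e^{iqx} a`. -/
def wave (ε q : ℝ) (a : C2) (x : ℝ) : C2 :=
  ((1 + (ε : ℂ) ^ 2 * (x : ℂ) ^ 2)⁻¹ * Complex.exp (Complex.I * q * x)) • a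

/-- The contribution of the cut-off to the derivative of `wave ε q a`. -/
def waveError (ε q : ℝ) (a : C2) (x : ℝ) : C2 :=
  (-(2 * (ε : ℂ) ^ 2 * x) / (1 + (ε : ℂ) ^ 2 * (x : ℂ) ^ 2) ^ 2
    * Complex.exp (Complex.I * q * x)) • a

variable (ε q : ℝ) (a : C2)

lemma one_add_ne_zero (x : ℝ) : (1 + (ε : ℂ) ^ 2 * (x : ℂ) ^ 2) ≠ 0 := by
  have : (1 + ε ^ 2 * x ^ 2 : ℝ) ≠ 0 := by positivity
  exact_mod_cast this

lemma continuous_wave : Continuous (wave ε q a) := by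
  unfold wave
  have h : Continuous fun x : ℝ => 1 + (ε : ℂ) ^ 2 * (x : ℂ) ^ 2 := by fun_prop
  have h' : Continuous fun x : ℝ => Complex.exp (Complex.I * q * x) := by fun_prop
  exact ((h.inv₀ (one_add_ne_zero ε)).mul h').smul continuous_const

lemma continuous_waveError : Continuous (waveError ε q a) := by
  unfold waveError
  have h : Continuous fun x : ℝ => (1 + (ε : ℂ) ^ 2 * (x : ℂ) ^ 2) ^ 2 := by fun_prop
  have h' : Continuous fun x : ℝ => Complex.exp (Complex.I * q * x) := by fun_prop
  have h'' : Continuous fun x : ℝ => -(2 * (ε : ℂ) ^ 2 * x) := by fun_prop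
  exact ((h''.div h fun x => pow_ne_zero 2 (one_add_ne_zero ε x)).mul h').smul continuous_const

lemma hasDerivAt_wave (x : ℝ) : HasDerivAt (wave ε q a)
    ((Complex.I * q) • wave ε q a x + waveError ε q a x) x := by
  have hx : HasDerivAt (fun x : ℝ => (x : ℂ)) 1 x := Complex.ofRealCLM.hasDerivAt (x := x)
  have h1 : HasDerivAt (fun x : ℝ => (1 + (ε : ℂ) ^ 2 * (x : ℂ) ^ 2))
      ((ε : ℂ) ^ 2 * (2 * x)) x := by
    simpa using ((hx.pow 2).const_mul ((ε : ℂ) ^ 2)).const_add 1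
  have h2 := h1.inv (one_add_ne_zero ε x)
  have h3 : HasDerivAt (fun x : ℝ => Complex.exp (Complex.I * q * x))
      (Complex.exp (Complex.I * q * x) * (Complex.I * q)) x := by
    simpa using (hx.const_mul (Complex.I * q)).cexp
  convert! (h2.mul h3).smul_const a using 1
  simp only [wave, waveError, Pi.inv_apply]
  module

lemma norm_wave (x : ℝ) : ‖wave ε q a x‖ = (1 + ε ^ 2 * x ^ 2)⁻¹ * ‖a‖ := by
  have h : Complex.I * q * x = ((q * x : ℝ) : ℂ) * Complex.I := by push_cast; ring
  have h1 : (1 + (ε : ℂ) ^ 2 * (x : ℂ) ^ 2)⁻¹ = (((1 + ε ^ 2 * x ^ 2)⁻¹ : ℝ) : ℂ) := by push_cast; rfl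
  rw [wave, norm_smul, norm_mul, h, Complex.norm_exp_ofReal_mul_I, mul_one, h1, Complex.norm_real,
    Real.norm_of_nonneg (by positivity)]

variable {ε}

lemma norm_waveError_le (hε : 0 < ε) (x : ℝ) : ‖waveError ε q a x‖ ≤ ε * ‖wave ε q a x‖ := by
  have h : Complex.I * q * x = ((q * x : ℝ) : ℂ) * Complex.I := by push_cast; ring
  have h1 : -(2 * (ε : ℂ) ^ 2 * x) / (1 + (ε : ℂ) ^ 2 * (x : ℂ) ^ 2) ^ 2
      = ((-(2 * ε ^ 2 * x) / (1 + ε ^ 2 * x ^ 2) ^ 2 : ℝ) : ℂ) := by push_cast; rfl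
  rw [norm_wave, waveError, norm_smul, norm_mul, h, Complex.norm_exp_ofReal_mul_I, mul_one, h1,
    Complex.norm_real, ← mul_assoc]
  refine mul_le_mul_of_nonneg_right ?_ (norm_nonneg _)
  have hp : 0 < 1 + ε ^ 2 * x ^ 2 := by positivity
  rw [Real.norm_eq_abs, abs_div, abs_neg, abs_of_pos (pow_pos hp 2), ← div_eq_mul_inv,
    div_le_div_iff₀ (pow_pos hp 2) hp, sq (1 + ε ^ 2 * x ^ 2), ← mul_assoc]
  refine mul_le_mul_of_nonneg_right ?_ hp.le
  rw [abs_le]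
  constructor <;> nlinarith [mul_nonneg hε.le (sq_nonneg (1 - ε * x)),
    mul_nonneg hε.le (sq_nonneg (1 + ε * x))]

lemma memLp_wave (hε : 0 < ε) : MemLp (wave ε q a) 2 (volume : Measure ℝ) := by
  rw [memLp_two_iff_integrable_sq_norm (continuous_wave ε q a).aestronglyMeasurable]
  have h : Integrable fun x : ℝ => (1 + (ε * x) ^ 2)⁻¹ * ‖a‖ ^ 2 :=
    (integrable_inv_one_add_sq.comp_mul_left' hε.ne').mul_const _
  refine h.mono' ((continuous_wave ε q a).norm.pow 2).aestronglyMeasurable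
    (Filter.Eventually.of_forall fun x => ?_)
  rw [Real.norm_of_nonneg (sq_nonneg _), norm_wave, mul_pow, ← mul_pow ε]
  refine mul_le_mul_of_nonneg_right ?_ (sq_nonneg _)
  refine pow_le_of_le_one (by positivity) (inv_le_one_of_one_le₀ ?_) two_ne_zero
  nlinarith [sq_nonneg (ε * x)]

lemma memLp_waveError (hε : 0 < ε) : MemLp (waveError ε q a) 2 (volume : Measure ℝ) :=
  (memLp_wave q a hε).of_le_mul (continuous_waveError ε q a).aestronglyMeasurable
    (Filter.Eventually.of_forall (norm_waveError_le q a hε))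

/-- On the interval `|x| ≤ 1/ε` the cut-off is at least `1/2`. -/
lemma le_lintegral_wave (hε : 0 < ε) :
    ENNReal.ofReal (‖a‖ ^ 2 / (2 * ε)) ≤ ∫⁻ x, ‖wave ε q a x‖ₑ ^ 2 := by
  calc ENNReal.ofReal (‖a‖ ^ 2 / (2 * ε))
      = ∫⁻ _ in Set.Icc (-ε⁻¹) ε⁻¹, ENNReal.ofReal (‖a‖ ^ 2 / 4) := by
        rw [setLIntegral_const, Real.volume_Icc, ← ENNReal.ofReal_mul (by positivity)]
        congr 1
        field_simp
        ring
    _ ≤ ∫⁻ x in Set.Icc (-ε⁻¹) ε⁻¹, ‖wave ε q a x‖ₑ ^ 2 := by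
        refine setLIntegral_mono' measurableSet_Icc fun x hx => ?_
        rw [← ofReal_norm, ← ENNReal.ofReal_pow (norm_nonneg _), norm_wave, mul_pow]
        refine ENNReal.ofReal_le_ofReal ?_
        have h1 : |ε * x| ≤ 1 := by
          rw [abs_mul, abs_of_pos hε, ← le_div_iff₀' hε, one_div]
          exact abs_le.2 hx
        have h2 : 1 + ε ^ 2 * x ^ 2 ≤ 2 := by
          rw [← mul_pow, ← sq_abs]
          nlinarith [abs_nonneg (ε * x)]
        have h3 : (2 : ℝ)⁻¹ ≤ (1 + ε ^ 2 * x ^ 2)⁻¹ := inv_anti₀ (by positivity) h2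
        have h4 := pow_le_pow_left₀ (by norm_num) h3 2
        nlinarith [sq_nonneg ‖a‖]
    _ ≤ _ := setLIntegral_le_lintegral _ _

lemma continuous_deriv_wave :
    Continuous fun t => (Complex.I * (q : ℂ)) • wave ε q a t + waveError ε q a t :=
  ((continuous_wave ε q a).const_smul (Complex.I * (q : ℂ))).add (continuous_waveError ε q a)

lemma integral_deriv_wave (x : ℝ) :
    wave ε q a x = wave ε q a 0
      + ∫ t in (0 : ℝ)..x, ((Complex.I * (q : ℂ)) • wave ε q a t + waveError ε q a t) := by
  rw [intervalIntegral.integral_eq_sub_of_hasDerivAt (fun t _ => hasDerivAt_wave ε q a t)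
    ((continuous_deriv_wave q a).intervalIntegrable _ _), add_sub_cancel]

variable {q a}

lemma exists_wave_eq (q : ℝ) (a : C2) (hε : 0 < ε) :
    ∃ f e : L2, f =ᵐ[volume] wave ε q a ∧ e =ᵐ[volume] waveError ε q a ∧
      HasL2Deriv f ((Complex.I * (q : ℂ)) • f + e) := by
  have hf := (memLp_wave q a hε).coeFn_toLp
  have he := (memLp_waveError q a hε).coeFn_toLp
  refine ⟨_, _, hf, he, wave ε q a 0, ?_⟩
  filter_upwards [hf] with x hx
  rw [hx, integral_deriv_wave]
  congr 1
  refine intervalIntegral.integral_congr_ae ?_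
  filter_upwards [hf, he, Lp.coeFn_add ((Complex.I * (q : ℂ)) • (memLp_wave q a hε).toLp)
      (memLp_waveError q a hε).toLp,
      Lp.coeFn_smul (Complex.I * (q : ℂ)) (memLp_wave q a hε).toLp] with t h1 h2 h3 h4 _
  rw [h3, Pi.add_apply, h4, Pi.smul_apply, h1, h2]

/-- For an eigenvector `a` of the coefficient matrix, only the cut-off prevents the wave from being an
eigenfunction of `H₀`. -/
lemma norm_freeDirac_wave_le {m lam : ℝ} (ha : coeffN m lam a = (Complex.I * q) • a)
    (hε : 0 < ε) {f e : L2} (hf : f =ᵐ[volume] wave ε q a) (he : e =ᵐ[volume] waveError ε q a)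
    (hfe : HasL2Deriv f ((Complex.I * (q : ℂ)) • f + e)) (hdom : f ∈ (freeDirac m).domain) :
    ‖freeDirac m ⟨f, hdom⟩ - (lam : ℂ) • f‖ ≤ ‖sigma1‖ * ε * ‖f‖ := by
  refine Lp.norm_le_mul_norm_of_ae_le_mul ?_
  filter_upwards [freeDirac_coeFn m hfe hdom, hf, he,
    Lp.coeFn_add ((Complex.I * (q : ℂ)) • f) e, Lp.coeFn_smul (Complex.I * (q : ℂ)) f,
    Lp.coeFn_sub (freeDirac m ⟨f, hdom⟩) ((lam : ℂ) • f), Lp.coeFn_smul (lam : ℂ) f]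
    with x h1 h2 h3 h4 h5 h6 h7
  have hNw : coeffN m lam (wave ε q a x) = (Complex.I * q) • wave ε q a x := by
    rw [wave, map_smul, ha, smul_comm]
  have h8 := dirac_coeffN (m := m) (z := lam) (wave ε q a x) 0
  rw [map_zero, smul_zero, add_zero, add_zero, hNw] at h8
  rw [h6, Pi.sub_apply, h1, h7, Pi.smul_apply, h4, Pi.add_apply, h5, Pi.smul_apply, h2, h3,
    ← h8, map_add, smul_add, add_right_comm, add_sub_cancel_left, norm_smul, norm_neg,
    Complex.norm_I, one_mul, mul_assoc]
  exact (sigma1.le_opNorm _).trans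
    (mul_le_mul_of_nonneg_left (norm_waveError_le q a hε x) (norm_nonneg _))

/-- An eigenvector of the coefficient matrix of `(H₀ - λ) f = 0` for real `λ`, `|λ| ≥ m`. -/
lemma exists_coeffN_eigenvector {m lam : ℝ} (hlam : m ^ 2 ≤ lam ^ 2) :
    ∃ (q : ℝ) (a : C2), a ≠ 0 ∧ coeffN m lam a = (Complex.I * q) • a := by
  refine ⟨√(lam ^ 2 - m ^ 2), ?_⟩
  set q := √(lam ^ 2 - m ^ 2) with hq
  have hq2 : (q : ℂ) * q = lam ^ 2 - m ^ 2 := by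
    have : q * q = lam ^ 2 - m ^ 2 := Real.mul_self_sqrt (by linarith)
    exact_mod_cast this
  by_cases h : (lam : ℂ) + m = 0
  · refine ⟨EuclideanSpace.single 1 1, by simp, ?_⟩
    have hq0 : (q : ℂ) = 0 := by
      rw [← mul_self_eq_zero, hq2]; linear_combination (lam - m : ℂ) * h
    refine ext_C2 ?_ ?_ <;>
    simp [coeffN, toEuclideanCLM_apply_zero, toEuclideanCLM_apply_one, hq0, h]
  · refine ⟨!₂[(lam : ℂ) + m, (q : ℂ)], fun h0 => h ?_, ?_⟩
    · simpa using congrArg (fun u : C2 => u 0) h0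
    · refine ext_C2 ?_ ?_ <;>
      simp only [coeffN, toEuclideanCLM_apply_zero, toEuclideanCLM_apply_one, PiLp.smul_apply,
        smul_eq_mul] <;> simp
      · ring
      · linear_combination -Complex.I * hq2

/-- The spectrum of `H₀` consists of approximate eigenvalues; the approximate eigenfunctions are
plane waves, cut off at the scale `1 / ε`, on which `|V|^{1/2}` is small because they are spread
out. -/
lemma exists_approximate_eigenfunction {m : ℝ} {V : ℝ → Matrix (Fin 2) (Fin 2) ℂ}
    (hV : ∀ i j : Fin 2, Integrable (fun x : ℝ => V x i j)) {lam : ℝ} (hlam : m ^ 2 ≤ lam ^ 2)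
    {δ : ℝ} (hδ : 0 < δ) :
    ∃ (f : (freeDirac m).domain) (hA : (f : L2) ∈ (mulOp (factorA V)).domain), (f : L2) ≠ 0 ∧
      ‖freeDirac m f - (lam : ℂ) • (f : L2)‖ ≤ δ * ‖(f : L2)‖ ∧
      ‖mulOp (factorA V) ⟨f, hA⟩‖ ≤ δ * ‖(f : L2)‖ := by
  set v := potNorm V with hv
  have hv0 : 0 ≤ v := integral_nonneg fun _ => norm_nonneg _
  obtain ⟨q, a, ha0, ha⟩ := exists_coeffN_eigenvector hlam
  -- the first bound controls the error of the cut-off, the second one the contribution of `A`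
  set ε := min (δ / (‖sigma1‖ + 1)) (δ ^ 2 / (2 * v + 1)) with hεdef
  have hε : 0 < ε := lt_min (by positivity) (by positivity)
  have hε1 : ‖sigma1‖ * ε ≤ δ := by
    have h1 : ε ≤ δ / (‖sigma1‖ + 1) := min_le_left _ _
    rw [le_div_iff₀ (by positivity)] at h1
    linarith
  have hε2 : 2 * ε * v ≤ δ ^ 2 := by
    have h1 : ε ≤ δ ^ 2 / (2 * v + 1) := min_le_right _ _
    rw [le_div_iff₀ (by positivity)] at h1
    linarith
  obtain ⟨f, e, hf, he, hfe⟩ := exists_wave_eq q a hε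
  have hdom := mem_freeDirac_domain m hfe
  have hfn : ENNReal.ofReal (‖a‖ ^ 2 / (2 * ε)) ≤ ‖f‖ₑ ^ 2 := by
    rw [← lintegral_enorm_sq]
    refine (le_lintegral_wave q a hε).trans (le_of_eq (lintegral_congr_ae ?_))
    filter_upwards [hf] with x hx
    rw [hx]
  have hsup : ∀ᵐ x, ‖f x‖ₑ ≤ ENNReal.ofReal ‖a‖ := by
    filter_upwards [hf] with x hx
    rw [hx, ← ofReal_norm, norm_wave]
    refine ENNReal.ofReal_le_ofReal (mul_le_of_le_one_left (norm_nonneg _) ?_)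
    refine inv_le_one_of_one_le₀ ?_
    rw [← mul_pow]
    linarith [sq_nonneg (ε * x)]
  have hA := mem_factorA_domain hV hsup ENNReal.ofReal_ne_top
  have hapos : 0 < ‖a‖ := norm_pos_iff.2 ha0
  refine ⟨⟨f, hdom⟩, hA, ?_, (norm_freeDirac_wave_le ha hε hf he hfe hdom).trans
    (mul_le_mul_of_nonneg_right hε1 (norm_nonneg _)), ?_⟩
  · intro h0
    simp only at h0
    rw [h0, enorm_zero, zero_pow two_ne_zero, nonpos_iff_eq_zero, ENNReal.ofReal_eq_zero] at hfn
    have : 0 < ‖a‖ ^ 2 / (2 * ε) := by positivity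
    linarith
  · have h1 : ‖mulOp (factorA V) ⟨f, hA⟩‖ₑ ^ 2 ≤ ENNReal.ofReal (δ ^ 2) * ‖f‖ₑ ^ 2 := by
      refine (enorm_factorA_sq_le hV hA hsup).trans
        (le_trans ?_ (mul_le_mul_right hfn _))
      rw [← ENNReal.ofReal_pow hapos.le, ← ENNReal.ofReal_mul hv0,
        ← ENNReal.ofReal_mul (sq_nonneg _)]
      refine ENNReal.ofReal_le_ofReal ?_
      rw [mul_div_assoc', le_div_iff₀ (by positivity)]
      calc v * ‖a‖ ^ 2 * (2 * ε) = 2 * ε * v * ‖a‖ ^ 2 := by ring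
        _ ≤ _ := mul_le_mul_of_nonneg_right hε2 (sq_nonneg _)
    have h2 := norm_le_of_enorm_sq_le ENNReal.ofReal_ne_top h1
    rwa [ENNReal.toReal_ofReal (sq_nonneg _), Real.sqrt_sq hδ.le] at h2

end ApproximateEigenfunctions

/-! ### The two disks -/

section Disks

variable {m v : ℝ} {z k : ℂ}

lemma r₀_sq (hv0 : 0 ≤ v) (hv1 : v < 1) : r₀ v ^ 2 = v ^ 4 / (4 * (1 - v ^ 2)) := by
  have h : 0 < 1 - v ^ 2 := by nlinarith
  have e : (v ^ 4 - 2 * v ^ 2 + 2) / (4 * (1 - v ^ 2)) - 1 / 2 = v ^ 4 / (4 * (1 - v ^ 2)) := by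
    field_simp; ring
  rw [r₀, e, Real.sq_sqrt (by positivity)]

lemma x₀_sq (hv0 : 0 ≤ v) (hv1 : v < 1) : x₀ v ^ 2 = (2 - v ^ 2) ^ 2 / (4 * (1 - v ^ 2)) := by
  have h : 0 < 1 - v ^ 2 := by nlinarith
  have e : (v ^ 4 - 2 * v ^ 2 + 2) / (4 * (1 - v ^ 2)) + 1 / 2
      = (2 - v ^ 2) ^ 2 / (4 * (1 - v ^ 2)) := by
    field_simp; ring
  rw [x₀, e, Real.sq_sqrt (by positivity)]

lemma x₀_sq_sub_r₀_sq (hv0 : 0 ≤ v) (hv1 : v < 1) : x₀ v ^ 2 - r₀ v ^ 2 = 1 := by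
  have h : 0 < 1 - v ^ 2 := by nlinarith
  rw [x₀_sq hv0 hv1, r₀_sq hv0 hv1]
  field_simp
  ring

lemma r₀_nonneg (v : ℝ) : 0 ≤ r₀ v := Real.sqrt_nonneg _

lemma x₀_nonneg (v : ℝ) : 0 ≤ x₀ v := Real.sqrt_nonneg _

lemma disjoint_disks (hm : 0 ≤ m) (hv0 : 0 ≤ v) (hv1 : v < 1) :
    Disjoint (disk (m * r₀ v) ((m * x₀ v : ℝ) : ℂ)) (disk (m * r₀ v) ((-(m * x₀ v) : ℝ) : ℂ)) := by
  rw [Set.disjoint_left]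
  rintro z ⟨hr, h1⟩ ⟨_, h2⟩
  have h3 := (dist_triangle_left _ _ z).trans (add_le_add h1 h2)
  rw [Complex.dist_of_im_eq (by simp), Complex.ofReal_re, Complex.ofReal_re, Real.dist_eq,
    sub_neg_eq_add, abs_of_nonneg (by have := x₀_nonneg v; positivity)] at h3
  have h4 : r₀ v < x₀ v := by
    have := x₀_sq_sub_r₀_sq hv0 hv1
    nlinarith [r₀_nonneg v, x₀_nonneg v]
  have hm' : 0 < m := by
    rcases hm.eq_or_lt with rfl | h
    · simp at hr
    · exact h
  nlinarith

/-- A point `z` outside of the disk around `m x₀` satisfies `2 m x₀ Re z < |z|² + m²`, because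
`x₀² - r₀² = 1`. The same holds for the other disk, with `x = -m x₀` in place of `x = m x₀`. -/
lemma lt_of_not_mem_disk (hv0 : 0 ≤ v) (hv1 : v < 1) (hr : 0 < m * r₀ v) {x : ℝ}
    (hx : x ^ 2 = (m * x₀ v) ^ 2) (hz : z ∉ disk (m * r₀ v) (x : ℂ)) :
    2 * x * z.re < z.re ^ 2 + z.im ^ 2 + m ^ 2 := by
  have h1 : m * r₀ v < dist z x := by
    by_contra! h
    exact hz ⟨hr, h⟩
  have h2 := pow_lt_pow_left₀ h1 hr.le two_ne_zero
  rw [Complex.dist_eq, ← Complex.normSq_eq_norm_sq, Complex.normSq_apply] at h2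
  simp only [Complex.sub_re, Complex.sub_im, Complex.ofReal_re, Complex.ofReal_im, sub_zero] at h2
  have h3 := x₀_sq_sub_r₀_sq hv0 hv1
  have h4 : (m * x₀ v) ^ 2 - (m * r₀ v) ^ 2 = m ^ 2 := by
    rw [mul_pow, mul_pow, ← mul_sub, h3, mul_one]
  nlinarith

/-- Outside of the two disks the Birman–Schwinger operator is a strict contraction. -/
lemma kernelBound_mul_lt_one (hm : 0 ≤ m) (hv0 : 0 ≤ v) (hv1 : v < 1)
    (hkz : k ^ 2 = z ^ 2 - m ^ 2) (hk0 : k ≠ 0)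
    (h₁ : z ∉ disk (m * r₀ v) ((m * x₀ v : ℝ) : ℂ))
    (h₂ : z ∉ disk (m * r₀ v) ((-(m * x₀ v) : ℝ) : ℂ)) : kernelBound m z k * v < 1 := by
  have hkpos : 0 < ‖k‖ := norm_pos_iff.2 hk0
  set s := ‖z + m‖ with hs
  set d := ‖z - m‖ with hd
  have hsd : s * d = ‖k‖ ^ 2 := by
    rw [hs, hd, ← norm_mul, ← norm_pow, hkz]; congr 1; ring
  have hs2 : s ^ 2 = (z.re + m) ^ 2 + z.im ^ 2 := by
    rw [hs, ← Complex.normSq_eq_norm_sq, Complex.normSq_apply]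
    simp; ring
  have hd2 : d ^ 2 = (z.re - m) ^ 2 + z.im ^ 2 := by
    rw [hd, ← Complex.normSq_eq_norm_sq, Complex.normSq_apply]
    simp; ring
  have hsd0 : 0 < s * d := by rw [hsd]; positivity
  have hs0 : 0 ≤ s := norm_nonneg _
  have hd0 : 0 ≤ d := norm_nonneg _
  -- this is the square of `(s + d) v < 2 |k|`
  suffices h : v ^ 2 * (s ^ 2 + d ^ 2) < (4 - 2 * v ^ 2) * (s * d) by
    rw [kernelBound, div_mul_eq_mul_div, div_lt_one (by positivity)]
    refine lt_of_pow_lt_pow_left₀ 2 (by positivity) ?_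
    nlinarith
  have h1v : 0 < 1 - v ^ 2 := by nlinarith
  rcases (mul_nonneg hm (r₀_nonneg v)).eq_or_lt with hr | hr
  · -- the disks are empty: `m = 0` or `v = 0`
    rcases mul_eq_zero.1 hr.symm with rfl | h0
    · have : s = d := by rw [hs, hd]; simp
      rw [this] at hsd0 ⊢
      nlinarith
    · have h0' := r₀_sq hv0 hv1
      rw [h0, zero_pow two_ne_zero, eq_comm, div_eq_zero_iff] at h0'
      have hv : v = 0 := by
        rcases h0' with h | h
        · exact pow_eq_zero_iff (by norm_num) |>.1 h
        · linarith
      rw [hv]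
      nlinarith
  · have e1 := lt_of_not_mem_disk hv0 hv1 hr rfl h₁
    have e2 := lt_of_not_mem_disk hv0 hv1 hr (neg_sq _) h₂
    have hP : s ^ 2 + d ^ 2 = 2 * (z.re ^ 2 + z.im ^ 2 + m ^ 2) := by rw [hs2, hd2]; ring
    have hM : s ^ 2 - d ^ 2 = 4 * m * z.re := by rw [hs2, hd2]; ring
    have e3 : (x₀ v * (s ^ 2 - d ^ 2)) ^ 2 < (s ^ 2 + d ^ 2) ^ 2 := by
      rw [sq_lt_sq, abs_of_nonneg (by positivity : 0 ≤ s ^ 2 + d ^ 2), abs_lt, hP, hM]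
      constructor <;> linarith
    rw [mul_pow, x₀_sq hv0 hv1, div_mul_eq_mul_div, div_lt_iff₀ (by positivity)] at e3
    -- insert `(s² - d²)² = (s² + d²)² - 4 (s d)²` into `e3`
    have e4 : (v ^ 2 * (s ^ 2 + d ^ 2)) ^ 2 < ((4 - 2 * v ^ 2) * (s * d)) ^ 2 := by
      have : ((4 - 2 * v ^ 2) * (s * d)) ^ 2 - (v ^ 2 * (s ^ 2 + d ^ 2)) ^ 2
        = (s ^ 2 + d ^ 2) ^ 2 * (4 * (1 - v ^ 2)) - (2 - v ^ 2) ^ 2 * (s ^ 2 - d ^ 2) ^ 2 := by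
        ring
      linarith
    exact lt_of_pow_lt_pow_left₀ 2 (by nlinarith) e4

end Disks

/-! ### The perturbed operator and its spectrum -/

section Spectrum

variable {m : ℝ} {V : ℝ → Matrix (Fin 2) (Fin 2) ℂ}

/-- Off the set `{λ ∈ ℝ : |λ| ≥ m}`, the number `z² - m²` has a square root in the upper
half-plane. -/
lemma exists_sqrt {z : ℂ} (hz : ¬ (z.im = 0 ∧ m ^ 2 ≤ z.re ^ 2)) :
    ∃ k : ℂ, k ^ 2 = z ^ 2 - m ^ 2 ∧ 0 < k.im := by
  obtain ⟨k, hk⟩ := IsAlgClosed.exists_pow_nat_eq (z ^ 2 - (m : ℂ) ^ 2) (n := 2) (by norm_num)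
  rcases lt_trichotomy k.im 0 with h | h | h
  · exact ⟨-k, by rw [neg_sq, hk], by simpa using h⟩
  · exfalso
    have hre := congrArg Complex.re hk
    have him := congrArg Complex.im hk
    simp only [sq, Complex.mul_re, Complex.mul_im, Complex.sub_re, Complex.sub_im,
      Complex.ofReal_re, Complex.ofReal_im, h] at hre him
    have h1 : z.re * z.im = 0 := by linarith
    rcases mul_eq_zero.1 h1 with h2 | h2
    · rw [h2] at hre
      refine hz ⟨?_, ?_⟩ <;> nlinarith [sq_nonneg k.re, sq_nonneg z.im, sq_nonneg m]
    · rw [h2] at hre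
      refine hz ⟨h2, ?_⟩
      nlinarith [sq_nonneg k.re]
  · exact ⟨k, hk, h⟩

lemma potNorm_nonneg (V : ℝ → Matrix (Fin 2) (Fin 2) ℂ) : 0 ≤ potNorm V :=
  integral_nonneg fun _ => norm_nonneg _

/-- Off the spectrum of `H₀` and the two disks, the resolvent formula applies. -/
lemma exists_BSData_isUnit (hm : 0 ≤ m) (hV : ∀ i j : Fin 2, Integrable (fun x : ℝ => V x i j))
    (hV1 : potNorm V < 1) {z : ℂ} (hz : ¬ (z.im = 0 ∧ m ^ 2 ≤ z.re ^ 2))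
    (h₁ : z ∉ disk (m * r₀ (potNorm V)) ((m * x₀ (potNorm V) : ℝ) : ℂ))
    (h₂ : z ∉ disk (m * r₀ (potNorm V)) ((-(m * x₀ (potNorm V)) : ℝ) : ℂ)) :
    ∃ D : BSData (freeDirac m) (mulOp (factorA V)) (mulOp (factorB V)) z, IsUnit (1 + D.Q) := by
  obtain ⟨k, hkz, hk⟩ := exists_sqrt hz
  have hk0 : k ≠ 0 := by rintro rfl; simp at hk
  obtain ⟨D, hD⟩ := exists_BSData hV hkz hk
  exact ⟨D, isUnit_one_add (hD.trans_lt
    (kernelBound_mul_lt_one hm (potNorm_nonneg V) hV1 hkz hk0 h₁ h₂))⟩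

/-- The disks do not meet the imaginary axis, because `r₀ < x₀`. -/
lemma I_not_mem_disk {v : ℝ} (hv0 : 0 ≤ v) (hv1 : v < 1) {x : ℝ}
    (hx : x ^ 2 = (m * x₀ v) ^ 2) : Complex.I ∉ disk (m * r₀ v) (x : ℂ) := by
  rintro ⟨hr, h⟩
  have h2 := pow_le_pow_left₀ dist_nonneg h 2
  rw [Complex.dist_eq, ← Complex.normSq_eq_norm_sq, Complex.normSq_apply] at h2
  simp at h2
  have h4 : (m * x₀ v) ^ 2 - (m * r₀ v) ^ 2 = m ^ 2 := by
    rw [mul_pow, mul_pow, ← mul_sub, x₀_sq_sub_r₀_sq hv0 hv1, mul_one]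
  nlinarith

lemma exists_BSData_I (hm : 0 ≤ m) (hV : ∀ i j : Fin 2, Integrable (fun x : ℝ => V x i j))
    (hV1 : potNorm V < 1) :
    ∃ D : BSData (freeDirac m) (mulOp (factorA V)) (mulOp (factorB V)) Complex.I,
      IsUnit (1 + D.Q) :=
  exists_BSData_isUnit hm hV hV1 (by simp) (I_not_mem_disk (potNorm_nonneg V) hV1 rfl)
    (I_not_mem_disk (potNorm_nonneg V) hV1 (neg_sq _))

lemma existsUnique_isDirac (hm : 0 ≤ m) (hV : ∀ i j : Fin 2, Integrable (fun x : ℝ => V x i j))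
    (hV1 : potNorm V < 1) : ∃! H : L2 →ₗ.[ℂ] L2, IsDirac m V H := by
  obtain ⟨D, hD⟩ := exists_BSData_I hm hV hV1
  have hinj := D.formula_injective mulOp_isClosed hD
  have hH := isResolvent_ofResolvent Complex.I D.formula hinj
  refine ⟨ofResolvent Complex.I D.formula hinj, ⟨hH.isClosed,
    D.dense_range_formula (dense_freeDirac_domain m) hD, ?_,
    fun z D' hD' => D.isResolvent_formula D' hD hD' hH⟩,
    fun H hH' => (hH'.resolvent_formula _ D hD).operator_unique hH⟩
  refine LinearPMap.le_of_le_graph ?_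
  rintro ⟨f, g⟩ hfg
  obtain ⟨⟨f', hf0, hfV⟩, rfl, rfl⟩ := (LinearPMap.mem_graph_iff _).1 hfg
  rw [hH.mem_graph_iff]
  have hA : f' ∈ (mulOp (factorA V)).domain := by
    have := D.R₀_mem (freeDirac m ⟨f', hf0⟩ - Complex.I • f')
    rwa [D.isResolvent.2 ⟨f', hf0⟩] at this
  obtain ⟨hB, hBA⟩ := mulOp_factorB_factorA V hA hfV
  have := D.formula_apply_sum hD f' hf0 hA hB
  rwa [hBA] at this

variable {H : L2 →ₗ.[ℂ] L2}

/-- The spectrum of `H₀` is contained in the spectrum of `H`. -/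
lemma mem_spec_of_real (hm : 0 ≤ m) (hV : ∀ i j : Fin 2, Integrable (fun x : ℝ => V x i j))
    (hV1 : potNorm V < 1) (hH : IsDirac m V H) {lam : ℝ} (hlam : m ^ 2 ≤ lam ^ 2) :
    (lam : ℂ) ∈ spec H := by
  obtain ⟨D, hD⟩ := exists_BSData_I hm hV hV1
  exact D.mem_spec_of_approximate (hH.resolvent_formula _ D hD)
    fun δ hδ => exists_approximate_eigenfunction hV hlam hδ

/-- Off the spectrum of `H₀`, the spectrum of `H` lies in the two disks. -/
lemma spec_subset (hm : 0 ≤ m) (hV : ∀ i j : Fin 2, Integrable (fun x : ℝ => V x i j))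
    (hV1 : potNorm V < 1) (hH : IsDirac m V H) {z : ℂ} (hz : z ∈ spec H)
    (hz' : ¬ (z.im = 0 ∧ m ^ 2 ≤ z.re ^ 2)) :
    z ∈ disk (m * r₀ (potNorm V)) ((m * x₀ (potNorm V) : ℝ) : ℂ) ∪
      disk (m * r₀ (potNorm V)) ((-(m * x₀ (potNorm V)) : ℝ) : ℂ) := by
  by_contra h
  rw [Set.mem_union, not_or] at h
  obtain ⟨D, hD⟩ := exists_BSData_isUnit hm hV hV1 hz' h.1 h.2
  exact hz ⟨_, hH.resolvent_formula z D hD⟩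

/-- The set `{λ ∈ ℝ : |λ| ≥ m}` lies in the spectrum and has no isolated points. -/
lemma not_isolated_of_real (hm : 0 ≤ m) (hV : ∀ i j : Fin 2, Integrable (fun x : ℝ => V x i j))
    (hV1 : potNorm V < 1) (hH : IsDirac m V H) {z : ℂ} (hz : z.im = 0 ∧ m ^ 2 ≤ z.re ^ 2)
    {ε : ℝ} (hε : 0 < ε) : ∃ w ∈ spec H, dist w z < ε ∧ w ≠ z := by
  have key : ∀ t : ℝ, |t| = ε / 2 → m ^ 2 ≤ (z.re + t) ^ 2 →
      ∃ w ∈ spec H, dist w z < ε ∧ w ≠ z := by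
    intro t ht hmt
    refine ⟨((z.re + t : ℝ) : ℂ), mem_spec_of_real hm hV hV1 hH hmt, ?_, fun h => ?_⟩
    · rw [Complex.dist_of_im_eq (by simp [hz.1]), Complex.ofReal_re, Real.dist_eq,
        add_sub_cancel_left, ht]
      linarith
    · have := congrArg Complex.re h
      rw [Complex.ofReal_re, add_eq_left] at this
      rw [this, abs_zero] at ht
      linarith
  rcases le_total 0 z.re with h | h
  · exact key (ε / 2) (abs_of_pos (by positivity)) (by nlinarith [hz.2])
  · exact key (-(ε / 2)) (by rw [abs_neg, abs_of_pos (by positivity)]) (by nlinarith [hz.2])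

end Spectrum

end Dirac

end

theorem theorem1 (m : ℝ) (hm : 0 ≤ m) (V : ℝ → Matrix (Fin 2) (Fin 2) ℂ)
    (hV : ∀ i j : Fin 2, MeasureTheory.Integrable (fun x : ℝ => V x i j))
    (hV1 : Dirac.potNorm V < 1) :
    (∃! H : Dirac.L2 →ₗ.[ℂ] Dirac.L2, Dirac.IsDirac m V H) ∧
    ∀ H : Dirac.L2 →ₗ.[ℂ] Dirac.L2, Dirac.IsDirac m V H →
      Disjoint
        (Dirac.disk (m * Dirac.r₀ (Dirac.potNorm V)) ((m * Dirac.x₀ (Dirac.potNorm V) : ℝ) : ℂ))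
        (Dirac.disk (m * Dirac.r₀ (Dirac.potNorm V)) ((-(m * Dirac.x₀ (Dirac.potNorm V)) : ℝ) : ℂ)) ∧
      Dirac.discreteSpec H ⊆
        Dirac.disk (m * Dirac.r₀ (Dirac.potNorm V)) ((m * Dirac.x₀ (Dirac.potNorm V) : ℝ) : ℂ) ∪
        Dirac.disk (m * Dirac.r₀ (Dirac.potNorm V)) ((-(m * Dirac.x₀ (Dirac.potNorm V)) : ℝ) : ℂ) ∧
      (m = 0 →
        (∀ z ∈ Dirac.pointSpec H, z.im = 0) ∧ Dirac.spec H = {z : ℂ | z.im = 0}) := by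
  refine ⟨Dirac.existsUnique_isDirac hm hV hV1, fun H hH =>
    ⟨Dirac.disjoint_disks hm (Dirac.potNorm_nonneg V) hV1, ?_, ?_⟩⟩
  · rintro z ⟨hp, -, ε, hε, hiso⟩
    refine Dirac.spec_subset hm hV hV1 hH (Dirac.pointSpec_subset_spec H hp) fun hz => ?_
    obtain ⟨w, hw, hwz, hne⟩ := Dirac.not_isolated_of_real hm hV hV1 hH hz hε
    exact hne (hiso w hw hwz)
  · rintro rfl
    have h1 : ∀ z ∈ Dirac.spec H, z.im = 0 := by
      intro z hz
      by_contra h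
      have := Dirac.spec_subset hm hV hV1 hH hz fun h' => h h'.1
      simp [Dirac.disk] at this
    refine ⟨fun z hz => h1 z (Dirac.pointSpec_subset_spec H hz), Set.Subset.antisymm h1 ?_⟩
    intro z hz
    have h2 : z = (z.re : ℂ) := Complex.ext rfl hz
    rw [h2]
    exact Dirac.mem_spec_of_real hm hV hV1 hH (by nlinarith [sq_nonneg z.re])
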